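/- Consider the channel with input process $\{X_i\}_{i\ge 0}$ and real-valued output process $\{Y_i\}_{i\ge 0}$ given by $$Y_0 = X_0+W_0+U_0,\qquad Y_n = X_n + A_nX_{n-1}+B_n(Y_{n-1}-E_{n-1})+W_n+U_n\quad (n\ge 1),$$ where - $\{X_i\}$ takes values in a finite nonempty alphabet $\mathcal X\subset\mathbb R$; - $\{A_i\}$, $\{B_i\}$, $\{E_i\}$, $\{W_i\}$ are i.i.d. Gaussian processes with mean $0$ and variances $\sigma_A^2$, $\sigma_B^2$, $\sigma_E^2$ and $1$ respectively, with $0<\sigma_B^2<1$; - $\{U_i\}$ is i.i.d. with the uniform distribution on $(\alpha_1,\alpha_2)$, $0<\alpha_1<\alpha_2$; - the processes $\{A_i\},\{B_i\},\{E_i\},\{W_i\},\{U_i\},\{X_i\}$ are mutually independent. For $n\ge 0$ let $$C_{n+1}=\frac{1}{n+1}\,\sup_{p(x_0^n)} I(X_0^n;Y_0^n),$$ where the supremum is over all probability distributions $p(x_0^n)$ of the input block $X_0^n=(X_0,\dots,X_n)$ on $\mathcal X^{n+1}$, and $I(X_0^n;Y_0^n)$ is the mutual information of $X_0^n$ and the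 output block $Y_0^n=(Y_0,\dots,Y_n)$. **Theorem.** Every $C_{n+1}$ is finite and the limit $C_{\mathrm{Shannon}}=\lim_{n\to\infty}C_{n+1}$ exists as a finite real number; that is, the information capacity $C_{\mathrm{Shannon}}$ of the channel is well-defined. -/

import Mathlib

open MeasureTheory ProbabilityTheory Filter Topology
open scoped NNReal ENNReal

namespace FlashChannel

/-- The mutual information `I(X; Y)` (in nats) of two random variables on `(Ω, P)`: the relative
entropy of their joint law with respect to the product of their marginal laws. -/
noncomputable def mutualInfo {Ω α β : Type*} [MeasurableSpace Ω] [MeasurableSpace α]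
    [MeasurableSpace β] (X : Ω → α) (Y : Ω → β) (P : Measure Ω) : ℝ≥0∞ :=
  InformationTheory.klDiv (P.map (fun ω => (X ω, Y ω))) ((P.map X).prod (P.map Y))

/-- The noise of the channel: `A i`, `B i`, `E i`, `W i` are centred Gaussian with variances
`σA ^ 2`, `σB ^ 2`, `σE ^ 2` and `1`, the `U i` are uniform on the interval `(α₁, α₂)`, and all
these random variables (over all five processes and all times) are mutually independent. -/
structure IsNoise {Ω : Type*} [MeasurableSpace Ω] (P : Measure Ω) (σA σB σE : ℝ≥0) (α₁ α₂ : ℝ)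
    (A B E W U : ℕ → Ω → ℝ) : Prop where
  measurable_A : ∀ i, Measurable (A i)
  measurable_B : ∀ i, Measurable (B i)
  measurable_E : ∀ i, Measurable (E i)
  measurable_W : ∀ i, Measurable (W i)
  measurable_U : ∀ i, Measurable (U i)
  law_A : ∀ i, P.map (A i) = gaussianReal 0 (σA ^ 2)
  law_B : ∀ i, P.map (B i) = gaussianReal 0 (σB ^ 2)
  law_E : ∀ i, P.map (E i) = gaussianReal 0 (σE ^ 2)
  law_W : ∀ i, P.map (W i) = gaussianReal 0 1
  law_U : ∀ i, pdf.IsUniform (U i) (Set.Ioo α₁ α₂) P volume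
  indep : iIndepFun (fun q : Fin 5 × ℕ => (![A, B, E, W, U] : Fin 5 → ℕ → Ω → ℝ) q.1 q.2) P

/-- The output `Y i` of the channel when the input sequence is `x` and the noise is frozen at `ω`:
`Y 0 = x 0 + W 0 + U 0` and
`Y n = x n + A n * x (n - 1) + B n * (Y (n - 1) - E (n - 1)) + W n + U n` for `n ≥ 1`. -/
def output {Ω : Type*} (A B E W U : ℕ → Ω → ℝ) (x : ℕ → ℝ) (ω : Ω) : ℕ → ℝ
  | 0 => x 0 + W 0 ω + U 0 ω
  | n + 1 => x (n + 1) + A (n + 1) ω * x n + B (n + 1) ω * (output A B E W U x ω n - E n ω)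
      + W (n + 1) ω + U (n + 1) ω

/-- A block `x_0, …, x_n` of letters seen as a real sequence. The value `0` after time `n` is
never used: outputs up to time `n` depend on the inputs up to time `n` only. -/
def extendBlock {𝒳 : Finset ℝ} {n : ℕ} (x : Fin (n + 1) → 𝒳) : ℕ → ℝ :=
  fun i => if h : i < n + 1 then (x ⟨i, h⟩ : ℝ) else 0

/-- The output block `(Y_0, …, Y_n)` for the input block `(x_0, …, x_n)`. -/
def outputBlock {Ω : Type*} (A B E W U : ℕ → Ω → ℝ) {𝒳 : Finset ℝ} {n : ℕ}
    (x : Fin (n + 1) → 𝒳) (ω : Ω) : Fin (n + 1) → ℝ :=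
  fun i => output A B E W U (extendBlock x) ω i

/-- `I(X_0^n; Y_0^n)` for the input law `p` on blocks of length `n + 1`. The input is independent
of the noise: the pair (input block, noise) has law `p ⊗ P`. -/
noncomputable def blockInfo {Ω : Type*} [MeasurableSpace Ω] (P : Measure Ω)
    (A B E W U : ℕ → Ω → ℝ) {𝒳 : Finset ℝ} {n : ℕ}
    (p : ProbabilityMeasure (Fin (n + 1) → 𝒳)) : ℝ≥0∞ :=
  mutualInfo (fun z : (Fin (n + 1) → 𝒳) × Ω => z.1)
    (fun z => outputBlock A B E W U z.1 z.2)
    ((p : Measure (Fin (n + 1) → 𝒳)).prod P)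

/-- `C_{n+1} = (1 / (n + 1)) * sup_p I(X_0^n; Y_0^n)`, the supremum being over all probability
distributions `p` of the input block `X_0^n` on `𝒳 ^ (n + 1)`. -/
noncomputable def blockCapacity {Ω : Type*} [MeasurableSpace Ω] (P : Measure Ω)
    (A B E W U : ℕ → Ω → ℝ) (𝒳 : Finset ℝ) (n : ℕ) : ℝ≥0∞ :=
  (⨆ p : ProbabilityMeasure (Fin (n + 1) → 𝒳), blockInfo P A B E W U p) / ((n : ℝ≥0∞) + 1)

end FlashChannel

/-!
The information of a block is superadditive up to a sublinear error, so that the normalized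
capacities converge by a version of Fekete's lemma
(`FlashChannel.exists_tendsto_div_of_almost_superadditive`). They are finite because the mutual
information is at most the logarithm of the number of input blocks.

Write `I(p)` for the information of a block with input law `p`, and `H(p)` for the entropy. A
*decoder* `q` gives a weight `q x y` to the input `x` when the output is `y`, with total weight at
most one for each `y`. Its score is `E[log q(X, Y)]`. By Gibbs' inequality
(`IsDensityChannel.entropy_add_decoderScore_le`), `I(p) ≥ H(p) + score`, for every decoder, and the
Bayes decoder attains equality. Two independent blocks sent one after the other can be decoded
separately, by the product of two decoders. For the first block nothing is lost, by causality. The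
second block starts from a state left by the first one, whereas its decoder was designed for the
channel started afresh. Two facts overcome this.

* A decoder may ignore the first `N` outputs of the block at a cost which depends on `N` but not on
  the length of the block (`exists_decoder`). The decoder is the Bayes decoder for densities in
  which the conditional densities of the outputs up to time `N` are replaced by the Laplace density
  `exp (-|y|) / 2`, and mixed with the uniform decoder. The true conditional densities are at most
  `1`, because of the Gaussian noise `W`, so the cost is at most a constant plus the sum of the first
  absolute moments of the ignored outputs (`IsDensityChannel.le_entropy_add_decoderScore`). These
  moments are bounded uniformly since `E|B| < 1` (`exists_forall_lintegral_enorm_chan_le`).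
* The outputs after time `N` nearly forget the state (`enorm_integral_chan_sub_restart_le`). Driven
  by the same noise, the outputs for two initial states have a difference that is multiplied by `B`
  at each step, hence is of order `E|B| ^ N` after `N` steps. The next Gaussian variable `W` turns
  this into a total variation distance of the same order. As the logarithm of the decoder is bounded
  by `log 2 + n * log (card 𝒳)`, the second block loses at most a small multiple of its length `n`.

All of this is done on the canonical space of the noise, where independence is used through the
resampling identity `map_piecewise_infinitePi`.
-/

set_option linter.unusedSectionVars false

namespace FlashChannel

/-! ### Mutual information of a finite-input channel with positive output densities -/

section Information

theorem klDiv_withDensity_ofReal {γ : Type*} [MeasurableSpace γ] {ρ : Measure γ} {a b : γ → ℝ}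
    (ha : Measurable a) (hb : Measurable b) (ha0 : ∀ z, 0 < a z) (hb0 : ∀ z, 0 < b z)
    {J K : Measure γ} [IsProbabilityMeasure J] [IsProbabilityMeasure K]
    (hJ : J = ρ.withDensity (fun z => ENNReal.ofReal (a z)))
    (hK : K = ρ.withDensity (fun z => ENNReal.ofReal (b z)))
    (hint : Integrable (fun z => Real.log (a z / b z)) J) :
    InformationTheory.klDiv J K = ENNReal.ofReal (∫ z, Real.log (a z / b z) ∂J) := by
  have hJK : J = K.withDensity (fun z => ENNReal.ofReal (a z / b z)) := by
    rw [hK, hJ, ← withDensity_mul _ (by fun_prop) (by fun_prop)]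
    congr 1
    ext z
    rw [Pi.mul_apply, ← ENNReal.ofReal_mul (hb0 z).le, mul_div_cancel₀ _ (hb0 z).ne']
  have hac : J ≪ K := by rw [hJK]; exact withDensity_absolutelyContinuous _ _
  have hrn : J.rnDeriv K =ᵐ[J] fun z => ENNReal.ofReal (a z / b z) := by
    apply hac.ae_le
    rw [show J.rnDeriv K = (K.withDensity fun z => ENNReal.ofReal (a z / b z)).rnDeriv K by rw [← hJK]]
    exact Measure.rnDeriv_withDensity K (by fun_prop)
  have hllr : llr J K =ᵐ[J] fun z => Real.log (a z / b z) := by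
    filter_upwards [hrn] with z hz
    rw [llr, hz, ENNReal.toReal_ofReal (div_pos (ha0 z) (hb0 z)).le]
  rw [InformationTheory.klDiv_of_ac_of_integrable hac (hint.congr hllr.symm),
    integral_congr_ae hllr]
  simp

variable {α β : Type*} [Fintype α] [MeasurableSpace α] [MeasurableSingletonClass α]
  [MeasurableSpace β]

/-- The density of the mixture of the densities `f x` with weights `p {x}`. -/
noncomputable def mixtureDensity (p : Measure α) (f : α → β → ℝ) (y : β) : ℝ :=
  ∑ x, p.real {x} * f x y

theorem sum_measureReal_singleton_eq_one (p : Measure α) [IsProbabilityMeasure p] :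
    ∑ x, p.real {x} = 1 := by
  rw [sum_measureReal_singleton]
  simp

theorem le_mixtureDensity (p : Measure α) {f : α → β → ℝ} (hf : ∀ x y, 0 < f x y) (x : α) (y : β) :
    p.real {x} * f x y ≤ mixtureDensity p f y :=
  Finset.single_le_sum (f := fun x => p.real {x} * f x y)
    (fun x _ => mul_nonneg measureReal_nonneg (hf x y).le) (Finset.mem_univ x)

theorem mixtureDensity_pos (p : Measure α) [IsProbabilityMeasure p] {f : α → β → ℝ}
    (hf : ∀ x y, 0 < f x y) (y : β) : 0 < mixtureDensity p f y := by
  have hne : ∑ x, p.real {x} ≠ 0 := by rw [sum_measureReal_singleton_eq_one]; exact one_ne_zero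
  obtain ⟨x, -, hx⟩ := Finset.exists_ne_zero_of_sum_ne_zero hne
  exact (mul_pos (lt_of_le_of_ne measureReal_nonneg hx.symm) (hf x y)).trans_le
    (le_mixtureDensity p hf x y)

@[fun_prop]
theorem measurable_mixtureDensity (p : Measure α) {f : α → β → ℝ} (hf : ∀ x, Measurable (f x)) :
    Measurable (mixtureDensity p f) := by
  unfold mixtureDensity
  fun_prop

/-- The joint law of an input with law `p` and of the output it produces, when the output law for
the input `x` is `ν x`. -/
noncomputable def jointLaw (p : Measure α) (ν : α → Measure β) : Measure (α × β) :=
  ∑ x, p {x} • (ν x).map (Prod.mk x)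

theorem lintegral_jointLaw (p : Measure α) (ν : α → Measure β) {F : α × β → ℝ≥0∞}
    (hF : Measurable F) :
    ∫⁻ z, F z ∂(jointLaw p ν) = ∑ x, p {x} * ∫⁻ y, F (x, y) ∂(ν x) := by
  rw [jointLaw, lintegral_finsetSum_measure]
  refine Finset.sum_congr rfl fun x _ => ?_
  rw [lintegral_smul_measure, lintegral_map hF measurable_prodMk_left, smul_eq_mul]

instance isProbabilityMeasure_jointLaw (p : Measure α) [IsProbabilityMeasure p]
    (ν : α → Measure β) [∀ x, IsProbabilityMeasure (ν x)] :
    IsProbabilityMeasure (jointLaw p ν) := by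
  constructor
  rw [← lintegral_one, lintegral_jointLaw p ν measurable_const]
  simp [sum_measure_singleton]

theorem integrable_jointLaw {p : Measure α} [IsFiniteMeasure p] {ν : α → Measure β}
    {F : α × β → ℝ} (hF : Measurable F)
    (h : ∀ x, p.real {x} ≠ 0 → Integrable (fun y => F (x, y)) (ν x)) :
    Integrable F (jointLaw p ν) := by
  rw [jointLaw, integrable_finsetSum_measure]
  intro x _
  by_cases hx : p {x} = 0
  · rw [hx, zero_smul]; exact integrable_zero_measure
  · refine Integrable.smul_measure ?_ (measure_ne_top _ _)
    rw [integrable_map_measure hF.aestronglyMeasurable measurable_prodMk_left.aemeasurable]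
    exact h x (by rwa [Ne, measureReal_eq_zero_iff])

theorem integral_jointLaw {p : Measure α} [IsFiniteMeasure p] {ν : α → Measure β}
    {F : α × β → ℝ} (hF : Measurable F)
    (h : ∀ x, p.real {x} ≠ 0 → Integrable (fun y => F (x, y)) (ν x)) :
    ∫ z, F z ∂(jointLaw p ν) = ∑ x, p.real {x} * ∫ y, F (x, y) ∂(ν x) := by
  have hi := integrable_jointLaw hF h
  rw [jointLaw] at hi ⊢
  rw [integral_finsetSum_measure (integrable_finsetSum_measure.1 hi)]
  refine Finset.sum_congr rfl fun x _ => ?_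
  rw [integral_smul_measure, integral_map measurable_prodMk_left.aemeasurable
    hF.aestronglyMeasurable, smul_eq_mul, measureReal_def]

theorem map_prodMk_eq_jointLaw {Ω : Type*} [MeasurableSpace Ω] (P : Measure Ω)
    [IsProbabilityMeasure P] (p : Measure α) [IsProbabilityMeasure p] {Y : α → Ω → β}
    (hY : ∀ x, Measurable (Y x)) :
    (p.prod P).map (fun z => (z.1, Y z.1 z.2)) = jointLaw p (fun x => P.map (Y x)) := by
  have hm : Measurable fun z : α × Ω => (z.1, Y z.1 z.2) :=
    measurable_fst.prodMk (measurable_from_prod_countable_right hY)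
  refine Measure.ext_of_lintegral _ fun F hF => ?_
  rw [lintegral_map hF hm, lintegral_jointLaw _ _ hF, lintegral_prod _ (by fun_prop),
    lintegral_fintype]
  refine Finset.sum_congr rfl fun x _ => ?_
  rw [lintegral_map (by fun_prop) (hY x), mul_comm]

variable {ρ : Measure β} [SigmaFinite ρ] {f : α → β → ℝ} {ν : α → Measure β}

theorem ofReal_mixtureDensity (p : Measure α) [IsFiniteMeasure p] (hf0 : ∀ x y, 0 < f x y)
    (y : β) :
    ENNReal.ofReal (mixtureDensity p f y) = ∑ x, p {x} * ENNReal.ofReal (f x y) := by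
  rw [mixtureDensity, ENNReal.ofReal_sum_of_nonneg
    fun x _ => mul_nonneg measureReal_nonneg (hf0 x y).le]
  refine Finset.sum_congr rfl fun x _ => ?_
  rw [ENNReal.ofReal_mul measureReal_nonneg, ofReal_measureReal]

theorem jointLaw_eq_withDensity (p : Measure α) [IsProbabilityMeasure p]
    (hf : ∀ x, Measurable (f x)) (hν : ∀ x, ν x = ρ.withDensity (fun y => ENNReal.ofReal (f x y))) :
    jointLaw p ν = (p.prod ρ).withDensity (fun z => ENNReal.ofReal (f z.1 z.2)) := by
  have hm : Measurable fun z : α × β => ENNReal.ofReal (f z.1 z.2) :=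
    (measurable_from_prod_countable_right (f := fun z : α × β => f z.1 z.2) hf).ennreal_ofReal
  refine Measure.ext_of_lintegral _ fun F hF => ?_
  rw [lintegral_jointLaw _ _ hF, lintegral_withDensity_eq_lintegral_mul _ hm hF,
    lintegral_prod _ (by fun_prop), lintegral_fintype]
  refine Finset.sum_congr rfl fun x _ => ?_
  rw [hν x, lintegral_withDensity_eq_lintegral_mul _ (hf x).ennreal_ofReal (by fun_prop), mul_comm]
  rfl

theorem map_snd_jointLaw (p : Measure α) [IsProbabilityMeasure p]
    (hf : ∀ x, Measurable (f x)) (hf0 : ∀ x y, 0 < f x y)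
    (hν : ∀ x, ν x = ρ.withDensity (fun y => ENNReal.ofReal (f x y))) :
    (jointLaw p ν).map Prod.snd =
      ρ.withDensity (fun y => ENNReal.ofReal (mixtureDensity p f y)) := by
  refine Measure.ext_of_lintegral _ fun F hF => ?_
  rw [lintegral_map hF measurable_snd, lintegral_jointLaw _ _ (by fun_prop),
    lintegral_withDensity_eq_lintegral_mul _ (by fun_prop) hF]
  simp_rw [Pi.mul_apply, ofReal_mixtureDensity p hf0, Finset.sum_mul]
  rw [lintegral_finsetSum _ (by fun_prop)]
  refine Finset.sum_congr rfl fun x _ => ?_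
  rw [hν x, lintegral_withDensity_eq_lintegral_mul _ (hf x).ennreal_ofReal (by fun_prop),
    ← lintegral_const_mul _ (by fun_prop)]
  simp [mul_assoc]

theorem map_fst_jointLaw (p : Measure α) [IsProbabilityMeasure p]
    [∀ x, IsProbabilityMeasure (ν x)] :
    (jointLaw p ν).map Prod.fst = p := by
  refine Measure.ext_of_lintegral _ fun F hF => ?_
  rw [lintegral_map hF measurable_fst, lintegral_jointLaw _ _ (by fun_prop), lintegral_fintype]
  refine Finset.sum_congr rfl fun x _ => ?_
  simp [mul_comm]

/-- A family of channel output laws given by positive densities with respect to `ρ`. -/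
structure IsDensityChannel (ρ : Measure β) (f : α → β → ℝ) (ν : α → Measure β) : Prop where
  measurable : ∀ x, Measurable (f x)
  pos : ∀ x y, 0 < f x y
  prob : ∀ x, IsProbabilityMeasure (ν x)
  eq : ∀ x, ν x = ρ.withDensity (fun y => ENNReal.ofReal (f x y))


theorem IsDensityChannel.lintegral (h : IsDensityChannel ρ f ν) (x : α) {F : β → ℝ≥0∞}
    (hF : Measurable F) :
    ∫⁻ y, F y ∂(ν x) = ∫⁻ y, ENNReal.ofReal (f x y) * F y ∂ρ := by
  rw [h.eq x, lintegral_withDensity_eq_lintegral_mul _ (h.measurable x).ennreal_ofReal hF]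
  rfl

end Information

section Information
variable {α β : Type*} [Fintype α] [MeasurableSpace α] [MeasurableSingletonClass α]
  [MeasurableSpace β] {ρ : Measure β} [SigmaFinite ρ] {f : α → β → ℝ} {ν : α → Measure β}

theorem IsDensityChannel.lintegral_mixtureDensity (h : IsDensityChannel ρ f ν) (p : Measure α)
    [IsProbabilityMeasure p] : ∫⁻ y, ENNReal.ofReal (mixtureDensity p f y) ∂ρ = 1 := by
  have := h.prob
  have h1 := map_snd_jointLaw p h.measurable h.pos h.eq
  have h2 : ((jointLaw p ν).map Prod.snd) Set.univ = 1 := by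
    rw [Measure.map_apply measurable_snd .univ]; simp
  rwa [h1, withDensity_apply _ .univ, Measure.restrict_univ] at h2

theorem IsDensityChannel.isProbabilityMeasure_mixture (h : IsDensityChannel ρ f ν) (p : Measure α)
    [IsProbabilityMeasure p] :
    IsProbabilityMeasure (ρ.withDensity fun y => ENNReal.ofReal (mixtureDensity p f y)) :=
  ⟨by rw [withDensity_apply _ .univ, Measure.restrict_univ, h.lintegral_mixtureDensity p]⟩

theorem IsDensityChannel.measurable_uncurry (h : IsDensityChannel ρ f ν) :
    Measurable fun z : α × β => f z.1 z.2 :=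
  measurable_from_prod_countable_right (f := fun z : α × β => f z.1 z.2) h.measurable

theorem IsDensityChannel.lintegral_mixtureDensity_div (h : IsDensityChannel ρ f ν) (p : Measure α)
    [IsProbabilityMeasure p] (x : α) :
    ∫⁻ y, ENNReal.ofReal (mixtureDensity p f y / f x y) ∂(ν x) = 1 := by
  have hm := h.measurable
  rw [h.lintegral x (by fun_prop)]
  simp_rw [← ENNReal.ofReal_mul (h.pos x _).le, mul_div_cancel₀ _ (h.pos x _).ne']
  exact h.lintegral_mixtureDensity p

theorem IsDensityChannel.integrable_mixtureDensity_div (h : IsDensityChannel ρ f ν)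
    (p : Measure α) [IsProbabilityMeasure p] (x : α) :
    Integrable (fun y => mixtureDensity p f y / f x y) (ν x) := by
  have hm := h.measurable
  refine ⟨(by fun_prop : Measurable _).aestronglyMeasurable, ?_⟩
  rw [hasFiniteIntegral_iff_ofReal
    (ae_of_all _ fun y => (div_pos (mixtureDensity_pos p h.pos y) (h.pos x y)).le),
    h.lintegral_mixtureDensity_div p]
  exact ENNReal.one_lt_top

/-- The information density is integrable: it is at most `log (1 / p {x})`, and it is bounded below
by `-(mixture / f x)`, whose integral against `f x` is `-1`. -/
theorem IsDensityChannel.integrable_log_div (h : IsDensityChannel ρ f ν) (p : Measure α)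
    [IsProbabilityMeasure p] (x : α) (hx : p.real {x} ≠ 0) :
    Integrable (fun y => Real.log (f x y / mixtureDensity p f y)) (ν x) := by
  have := h.prob
  have hm := h.measurable
  have hpx : 0 < p.real {x} := lt_of_le_of_ne measureReal_nonneg hx.symm
  have hr := h.integrable_mixtureDensity_div p x
  refine (hr.add (integrable_const |Real.log (1 / p.real {x})|)).mono'
    (by fun_prop : Measurable _).aestronglyMeasurable (ae_of_all _ fun y => ?_)
  have hf := h.pos x y
  have hmix := mixtureDensity_pos p h.pos y
  have h1 : Real.log (f x y / mixtureDensity p f y) ≤ Real.log (1 / p.real {x}) := by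
    apply Real.log_le_log (by positivity)
    rw [div_le_div_iff₀ hmix hpx]
    linarith [le_mixtureDensity p h.pos x y]
  have h2 : - Real.log (f x y / mixtureDensity p f y) ≤ mixtureDensity p f y / f x y := by
    rw [← Real.log_inv, inv_div]
    linarith [Real.log_le_sub_one_of_pos (div_pos hmix hf)]
  have h3 := le_abs_self (Real.log (1 / p.real {x}))
  have h4 : 0 < mixtureDensity p f y / f x y := by positivity
  have h5 := abs_nonneg (Real.log (1 / p.real {x}))
  rw [Real.norm_eq_abs, abs_le, Pi.add_apply]
  constructor <;> linarith

theorem IsDensityChannel.integrable_jointLaw_log_div (h : IsDensityChannel ρ f ν) (p : Measure α)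
    [IsProbabilityMeasure p] :
    Integrable (fun z : α × β => Real.log (f z.1 z.2 / mixtureDensity p f z.2))
      (jointLaw p ν) := by
  have := h.measurable_uncurry
  have := h.measurable
  exact integrable_jointLaw (by fun_prop) (h.integrable_log_div p)

/-- The mutual information is the expectation of the information density. -/
theorem IsDensityChannel.mutualInfo_eq (h : IsDensityChannel ρ f ν) (p : Measure α)
    [IsProbabilityMeasure p] {Ω : Type*} [MeasurableSpace Ω] (P : Measure Ω)
    [IsProbabilityMeasure P] {Y : α → Ω → β} (hY : ∀ x, Measurable (Y x))
    (hν : ∀ x, P.map (Y x) = ν x) :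
    mutualInfo (fun z : α × Ω => z.1) (fun z => Y z.1 z.2) (p.prod P) = ENNReal.ofReal
      (∫ z, Real.log (f z.1 z.2 / mixtureDensity p f z.2) ∂(jointLaw p ν)) := by
  have := h.prob
  have hfm := h.measurable_uncurry
  have hfm' := h.measurable
  have hmY : Measurable fun z : α × Ω => Y z.1 z.2 :=
    measurable_from_prod_countable_right hY
  have hJ : (p.prod P).map (fun z => (z.1, Y z.1 z.2)) = jointLaw p ν := by
    rw [map_prodMk_eq_jointLaw P p hY]; simp_rw [hν]
  have h1 : (p.prod P).map (fun z => z.1) = p := by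
    rw [Measure.map_fst_prod]; simp
  have h2 : (p.prod P).map (fun z => Y z.1 z.2) =
      ρ.withDensity fun y => ENNReal.ofReal (mixtureDensity p f y) := by
    rw [← map_snd_jointLaw p h.measurable h.pos h.eq, ← hJ,
      Measure.map_map measurable_snd (measurable_fst.prodMk hmY)]
    rfl
  have := h.isProbabilityMeasure_mixture p
  rw [mutualInfo, hJ, h1, h2]
  refine klDiv_withDensity_ofReal (ρ := p.prod ρ) (a := fun z => f z.1 z.2)
    (b := fun z => mixtureDensity p f z.2) hfm (by fun_prop) (fun z => h.pos _ _)
    (fun z => mixtureDensity_pos p h.pos _) (jointLaw_eq_withDensity p h.measurable h.eq) ?_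
    (h.integrable_jointLaw_log_div p)
  rw [prod_withDensity_right (by fun_prop)]

/-- The Shannon entropy (in nats) of a law on a finite alphabet. -/
noncomputable def entropy (p : Measure α) : ℝ := ∑ x, Real.negMulLog (p.real {x})

/-- The expected log-score `E[log q(X, Y)]` of the decoder `q`, where `X` has law `p` and `Y` has
law `ν x` given `X = x`. -/
noncomputable def decoderScore (p : Measure α) (ν : α → Measure β) (q : α → β → ℝ) : ℝ :=
  ∑ x, p.real {x} * ∫ y, Real.log (q x y) ∂(ν x)

theorem entropy_le_log_card (p : Measure α) [IsProbabilityMeasure p] :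
    entropy p ≤ Real.log (Fintype.card α) := by
  have hne : Nonempty α := by
    by_contra hcon
    rw [not_nonempty_iff] at hcon
    simpa using sum_measureReal_singleton_eq_one p
  have hc : (0 : ℝ) < Fintype.card α := by exact_mod_cast Fintype.card_pos
  have key : ∀ x, Real.negMulLog (p.real {x}) ≤
      p.real {x} * Real.log (Fintype.card α) + ((Fintype.card α : ℝ)⁻¹ - p.real {x}) := by
    intro x
    rcases (measureReal_nonneg : 0 ≤ p.real {x}).eq_or_lt with h0 | h0
    · rw [← h0]; simp
    · have := Real.log_le_sub_one_of_pos (x := (Fintype.card α : ℝ)⁻¹ / p.real {x}) (by positivity)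
      rw [Real.log_div (by positivity) h0.ne', Real.log_inv] at this
      have h2 := mul_le_mul_of_nonneg_left this h0.le
      rw [mul_sub, mul_sub, mul_div_cancel₀ _ h0.ne'] at h2
      rw [Real.negMulLog]; linarith
  calc entropy p ≤ ∑ x, (p.real {x} * Real.log (Fintype.card α)
        + ((Fintype.card α : ℝ)⁻¹ - p.real {x})) := Finset.sum_le_sum fun x _ => key x
    _ = Real.log (Fintype.card α) := by
      rw [Finset.sum_add_distrib, ← Finset.sum_mul, Finset.sum_sub_distrib,
        sum_measureReal_singleton_eq_one p]
      simp [hc.ne']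

/-- A decoder: `q x y` is the weight given to the input `x` when the output is `y`; the weights are
bounded below by `δ` and have total mass at most one. -/
structure IsDecoder (δ : ℝ) (q : α → β → ℝ) : Prop where
  measurable : ∀ x, Measurable (q x)
  pos : 0 < δ
  le : ∀ x y, δ ≤ q x y
  sum_le_one : ∀ y, ∑ x, q x y ≤ 1

theorem IsDecoder.apply_pos {δ : ℝ} {q : α → β → ℝ} (hq : IsDecoder δ q) (x : α) (y : β) :
    0 < q x y := hq.pos.trans_le (hq.le x y)

theorem IsDecoder.le_one {δ : ℝ} {q : α → β → ℝ} (hq : IsDecoder δ q) (x : α) (y : β) :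
    q x y ≤ 1 :=
  (Finset.single_le_sum (f := fun x => q x y) (fun x _ => (hq.apply_pos x y).le)
    (Finset.mem_univ x)).trans (hq.sum_le_one y)

theorem IsDecoder.abs_log_le {δ : ℝ} {q : α → β → ℝ} (hq : IsDecoder δ q) (x : α) (y : β) :
    |Real.log (q x y)| ≤ -Real.log δ := by
  have h1 := Real.log_nonpos (hq.apply_pos x y).le (hq.le_one x y)
  rw [abs_of_nonpos h1]
  exact neg_le_neg (Real.log_le_log hq.pos (hq.le x y))

theorem IsDecoder.integrable_log {δ : ℝ} {q : α → β → ℝ} (hq : IsDecoder δ q) (x : α)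
    (μ : Measure β) [IsFiniteMeasure μ] : Integrable (fun y => Real.log (q x y)) μ := by
  have := hq.measurable x
  exact Integrable.of_bound (by fun_prop : Measurable _).aestronglyMeasurable (-Real.log δ)
    (ae_of_all _ fun y => hq.abs_log_le x y)

theorem IsDecoder.measurable_uncurry {δ : ℝ} {q : α → β → ℝ} (hq : IsDecoder δ q) :
    Measurable fun z : α × β => q z.1 z.2 :=
  measurable_from_prod_countable_right (f := fun z : α × β => q z.1 z.2) hq.measurable

theorem measurable_measureReal_singleton_fst (p : Measure α) :
    Measurable fun z : α × β => p.real {z.1} :=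
  (measurable_of_countable fun x : α => p.real {x}).comp measurable_fst

theorem IsDecoder.integrable_jointLaw_log_div {δ : ℝ} {q : α → β → ℝ} (hq : IsDecoder δ q)
    (p : Measure α) [IsProbabilityMeasure p] [∀ x, IsProbabilityMeasure (ν x)] :
    Integrable (fun z : α × β => Real.log (q z.1 z.2 / p.real {z.1})) (jointLaw p ν) := by
  have h1 := hq.measurable_uncurry
  have h2 : Measurable fun z : α × β => p.real {z.1} := measurable_measureReal_singleton_fst p
  refine integrable_jointLaw (by fun_prop) fun x hx => ?_
  simp_rw [fun y => Real.log_div (hq.apply_pos x y).ne' hx]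
  exact (hq.integrable_log x _).sub (integrable_const _)

theorem IsDecoder.integral_jointLaw_log_div {δ : ℝ} {q : α → β → ℝ} (hq : IsDecoder δ q)
    (p : Measure α) [IsProbabilityMeasure p] [∀ x, IsProbabilityMeasure (ν x)] :
    ∫ z, Real.log (q z.1 z.2 / p.real {z.1}) ∂(jointLaw p ν) =
      entropy p + decoderScore p ν q := by
  have h1 := hq.measurable_uncurry
  have h2 : Measurable fun z : α × β => p.real {z.1} := measurable_measureReal_singleton_fst p
  have h3 : ∀ x, p.real {x} ≠ 0 →
      Integrable (fun y => Real.log (q x y / p.real {x})) (ν x) := fun x hx => by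
    simp_rw [fun y => Real.log_div (hq.apply_pos x y).ne' hx]
    exact (hq.integrable_log x _).sub (integrable_const _)
  rw [integral_jointLaw (F := fun z => Real.log (q z.1 z.2 / p.real {z.1})) (by fun_prop) h3,
    entropy, decoderScore, ← Finset.sum_add_distrib]
  refine Finset.sum_congr rfl fun x _ => ?_
  by_cases hx : p.real {x} = 0
  · simp [hx]
  · simp_rw [fun y => Real.log_div (hq.apply_pos x y).ne' hx]
    rw [integral_sub (hq.integrable_log x _) (integrable_const _), Real.negMulLog]
    simp
    ring

/-- Gibbs' inequality: no decoder extracts more than the mutual information. -/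
theorem IsDensityChannel.entropy_add_decoderScore_le (h : IsDensityChannel ρ f ν) (p : Measure α)
    [IsProbabilityMeasure p] {δ : ℝ} {q : α → β → ℝ} (hq : IsDecoder δ q) :
    entropy p + decoderScore p ν q ≤
      ∫ z, Real.log (f z.1 z.2 / mixtureDensity p f z.2) ∂(jointLaw p ν) := by
  have := h.prob
  have hfm := h.measurable_uncurry
  have hfm' := h.measurable
  have hqm := hq.measurable_uncurry
  have hqm' := hq.measurable
  have hpm : Measurable fun z : α × β => p.real {z.1} := measurable_measureReal_singleton_fst p
  set R : α × β → ℝ := fun z => q z.1 z.2 * mixtureDensity p f z.2 / (p.real {z.1} * f z.1 z.2)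
    with hR
  have hRm : Measurable R := by fun_prop
  have hR0 : ∀ z, 0 ≤ R z := fun z => div_nonneg
    (mul_nonneg (hq.apply_pos _ _).le (mixtureDensity_pos p h.pos _).le)
    (mul_nonneg measureReal_nonneg (h.pos _ _).le)
  have hRint : ∫⁻ z, ENNReal.ofReal (R z) ∂(jointLaw p ν) ≤ 1 := by
    rw [lintegral_jointLaw _ _ (by fun_prop)]
    calc ∑ x, p {x} * ∫⁻ y, ENNReal.ofReal (R (x, y)) ∂(ν x)
        ≤ ∑ x, ∫⁻ y, ENNReal.ofReal (q x y * mixtureDensity p f y) ∂ρ := by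
          refine Finset.sum_le_sum fun x _ => ?_
          rw [h.lintegral x (by fun_prop), ← lintegral_const_mul _ (by fun_prop)]
          refine lintegral_mono fun y => ?_
          rw [← ofReal_measureReal (μ := p), ← ENNReal.ofReal_mul (h.pos x y).le,
            ← ENNReal.ofReal_mul measureReal_nonneg]
          apply ENNReal.ofReal_le_ofReal
          by_cases hx : p.real {x} = 0
          · rw [hx, zero_mul]
            exact mul_nonneg (hq.apply_pos _ _).le (mixtureDensity_pos p h.pos _).le
          · have := (h.pos x y).ne'
            simp only [hR]
            apply le_of_eq
            field_simp
      _ = ∫⁻ y, ∑ x, ENNReal.ofReal (q x y * mixtureDensity p f y) ∂ρ :=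
          (lintegral_finsetSum _ (by fun_prop)).symm
      _ ≤ ∫⁻ y, ENNReal.ofReal (mixtureDensity p f y) ∂ρ := by
          refine lintegral_mono fun y => ?_
          rw [← ENNReal.ofReal_sum_of_nonneg fun x _ =>
            mul_nonneg (hq.apply_pos _ _).le (mixtureDensity_pos p h.pos _).le, ← Finset.sum_mul]
          apply ENNReal.ofReal_le_ofReal
          exact mul_le_of_le_one_left (mixtureDensity_pos p h.pos _).le (hq.sum_le_one y)
      _ = 1 := h.lintegral_mixtureDensity p
  have hRi : Integrable R (jointLaw p ν) := by
    refine ⟨hRm.aestronglyMeasurable, ?_⟩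
    rw [hasFiniteIntegral_iff_ofReal (ae_of_all _ hR0)]
    exact hRint.trans_lt ENNReal.one_lt_top
  have hRle : ∫ z, R z ∂(jointLaw p ν) ≤ 1 := by
    rw [integral_eq_lintegral_of_nonneg_ae (ae_of_all _ hR0) hRm.aestronglyMeasurable]
    exact ENNReal.toReal_le_of_le_ofReal zero_le_one (by simpa using hRint)
  have hp0 : ∀ᵐ z ∂(jointLaw p ν), p.real {z.1} ≠ 0 := by
    have : ∀ᵐ x ∂((jointLaw p ν).map Prod.fst), p.real {x} ≠ 0 := by
      rw [map_fst_jointLaw, ae_iff_of_countable]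
      intro x hx
      rwa [Ne, measureReal_eq_zero_iff]
    exact ae_of_ae_map measurable_fst.aemeasurable this
  rw [← hq.integral_jointLaw_log_div p, ← sub_nonpos,
    ← integral_sub (hq.integrable_jointLaw_log_div p) (h.integrable_jointLaw_log_div p)]
  calc _ ≤ ∫ z, (R z - 1) ∂(jointLaw p ν) := by
        refine integral_mono_ae ((hq.integrable_jointLaw_log_div p).sub
          (h.integrable_jointLaw_log_div p)) (hRi.sub (integrable_const _)) ?_
        filter_upwards [hp0] with z hz
        have hz' : 0 < p.real {z.1} := lt_of_le_of_ne measureReal_nonneg hz.symm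
        have h1 := hq.apply_pos z.1 z.2
        have h2 := h.pos z.1 z.2
        have h3 := mixtureDensity_pos p h.pos z.2
        rw [← Real.log_div (by positivity) (by positivity)]
        have h4 : q z.1 z.2 / p.real {z.1} / (f z.1 z.2 / mixtureDensity p f z.2) = R z := by
          simp only [hR]; field_simp
        rw [h4]
        exact Real.log_le_sub_one_of_pos (by simp only [hR]; positivity)
    _ ≤ 0 := by
        rw [integral_sub hRi (integrable_const _)]
        simpa using hRle

end Information

section Information
variable {α β : Type*} [Fintype α] [MeasurableSpace α] [MeasurableSingletonClass α]
  [MeasurableSpace β] {ρ : Measure β} [SigmaFinite ρ] {f : α → β → ℝ} {ν : α → Measure β}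

/-- The Bayes decoder computed with the (possibly wrong) densities `g`, mixed with the uniform
decoder in order to be bounded below. -/
noncomputable def bayesDecoder (p : Measure α) (g : α → β → ℝ) (x : α) (y : β) : ℝ :=
  (p.real {x} * g x y / mixtureDensity p g y + (Fintype.card α : ℝ)⁻¹) / 2

theorem isDecoder_bayesDecoder [Nonempty α] (p : Measure α) [IsProbabilityMeasure p]
    {g : α → β → ℝ} (hg : ∀ x, Measurable (g x)) (hg0 : ∀ x y, 0 < g x y) :
    IsDecoder ((Fintype.card α : ℝ)⁻¹ / 2) (bayesDecoder p g) := by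
  have hc : (0 : ℝ) < Fintype.card α := by exact_mod_cast Fintype.card_pos
  refine ⟨fun x => ?_, by positivity, fun x y => ?_, fun y => ?_⟩
  · unfold bayesDecoder; fun_prop
  · have : 0 ≤ p.real {x} * g x y / mixtureDensity p g y :=
      div_nonneg (mul_nonneg measureReal_nonneg (hg0 x y).le) (mixtureDensity_pos p hg0 y).le
    unfold bayesDecoder
    linarith
  · simp only [bayesDecoder]
    rw [← Finset.sum_div, Finset.sum_add_distrib, ← Finset.sum_div]
    rw [show ∑ x, p.real {x} * g x y = mixtureDensity p g y from rfl,
      div_self (mixtureDensity_pos p hg0 y).ne']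
    simp [hc.ne']

/-- The Bayes decoder for the densities `g` loses a bounded amount of information when `f / g` is
at most `exp c` for a function `c` of the output with bounded expectation. -/
theorem IsDensityChannel.le_entropy_add_decoderScore [Nonempty α] (h : IsDensityChannel ρ f ν)
    (p : Measure α) [IsProbabilityMeasure p] {g : α → β → ℝ} (hg : ∀ x, Measurable (g x))
    (hg0 : ∀ x y, 0 < g x y) (hg1 : ∀ x, ∫⁻ y, ENNReal.ofReal (g x y) ∂ρ = 1)
    {c : β → ℝ} (hc : Measurable c) (hfg : ∀ x y, Real.log (f x y / g x y) ≤ c y)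
    (hci : ∀ x, Integrable c (ν x)) {K : ℝ} (hK : ∀ x, ∫ y, c y ∂(ν x) ≤ K) :
    ∫ z, Real.log (f z.1 z.2 / mixtureDensity p f z.2) ∂(jointLaw p ν) ≤
      entropy p + decoderScore p ν (bayesDecoder p g) + Real.log 2 + K := by
  have := h.prob
  have hfm := h.measurable_uncurry
  have hfm' := h.measurable
  have hq := isDecoder_bayesDecoder p hg hg0
  have hgch : IsDensityChannel ρ g (fun x => ρ.withDensity fun y => ENNReal.ofReal (g x y)) :=
    ⟨hg, hg0, fun x => ⟨by rw [withDensity_apply _ .univ, Measure.restrict_univ, hg1]⟩,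
      fun _ => rfl⟩
  set R : β → ℝ := fun y => mixtureDensity p g y / mixtureDensity p f y with hR
  have hRm : Measurable R := by fun_prop
  have hR0 : ∀ y, 0 ≤ R y := fun y =>
    (div_pos (mixtureDensity_pos p hg0 y) (mixtureDensity_pos p h.pos y)).le
  have hRint : ∫⁻ z, ENNReal.ofReal (R z.2) ∂(jointLaw p ν) = 1 := by
    rw [← lintegral_map (f := fun y => ENNReal.ofReal (R y)) (by fun_prop) measurable_snd,
      map_snd_jointLaw p h.measurable h.pos h.eq,
      lintegral_withDensity_eq_lintegral_mul _ (by fun_prop) (by fun_prop),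
      ← hgch.lintegral_mixtureDensity p]
    refine lintegral_congr fun y => ?_
    have := mixtureDensity_pos p h.pos y
    rw [Pi.mul_apply, ← ENNReal.ofReal_mul this.le, mul_div_cancel₀ _ this.ne']
  have hRi : Integrable (fun z : α × β => R z.2) (jointLaw p ν) := by
    refine ⟨(by fun_prop : Measurable _).aestronglyMeasurable, ?_⟩
    rw [hasFiniteIntegral_iff_ofReal (ae_of_all _ fun z => hR0 _), hRint]
    exact ENNReal.one_lt_top
  have hRone : ∫ z, R z.2 ∂(jointLaw p ν) = 1 := by
    rw [integral_eq_lintegral_of_nonneg_ae (ae_of_all _ fun z => hR0 _)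
      (by fun_prop : Measurable _).aestronglyMeasurable, hRint]
    simp
  have hci' : Integrable (fun z : α × β => c z.2) (jointLaw p ν) :=
    integrable_jointLaw (by fun_prop) fun x _ => hci x
  have hcK : ∫ z, c z.2 ∂(jointLaw p ν) ≤ K := by
    rw [integral_jointLaw (F := fun z => c z.2) (by fun_prop) fun x _ => hci x]
    calc ∑ x, p.real {x} * ∫ y, c y ∂(ν x) ≤ ∑ x, p.real {x} * K :=
          Finset.sum_le_sum fun x _ => mul_le_mul_of_nonneg_left (hK x) measureReal_nonneg
      _ = K := by rw [← Finset.sum_mul, sum_measureReal_singleton_eq_one, one_mul]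
  have hp0 : ∀ᵐ z ∂(jointLaw p ν), p.real {z.1} ≠ 0 := by
    have : ∀ᵐ x ∂((jointLaw p ν).map Prod.fst), p.real {x} ≠ 0 := by
      rw [map_fst_jointLaw, ae_iff_of_countable]
      intro x hx
      rwa [Ne, measureReal_eq_zero_iff]
    exact ae_of_ae_map measurable_fst.aemeasurable this
  rw [← hq.integral_jointLaw_log_div p]
  have hmono : ∫ z, Real.log (f z.1 z.2 / mixtureDensity p f z.2) ∂(jointLaw p ν) ≤
      ∫ z, (Real.log (bayesDecoder p g z.1 z.2 / p.real {z.1}) + (Real.log 2 + c z.2 +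
        (R z.2 - 1))) ∂(jointLaw p ν) := by
    refine integral_mono_ae (h.integrable_jointLaw_log_div p)
      ((hq.integrable_jointLaw_log_div p).add (((integrable_const _).add hci').add
        (hRi.sub (integrable_const _)))) ?_
    filter_upwards [hp0] with z hz
    have hz' : 0 < p.real {z.1} := lt_of_le_of_ne measureReal_nonneg hz.symm
    have h1 := hg0 z.1 z.2
    have h2 := h.pos z.1 z.2
    have h3 := mixtureDensity_pos p h.pos z.2
    have h4 := mixtureDensity_pos p hg0 z.2
    -- the uniform part of the decoder is dropped
    have h5 : g z.1 z.2 / mixtureDensity p g z.2 / 2 ≤ bayesDecoder p g z.1 z.2 / p.real {z.1} := by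
      rw [le_div_iff₀ hz', bayesDecoder]
      have : 0 ≤ (Fintype.card α : ℝ)⁻¹ := by positivity
      have h6 : g z.1 z.2 / mixtureDensity p g z.2 / 2 * p.real {z.1} =
        p.real {z.1} * g z.1 z.2 / mixtureDensity p g z.2 / 2 := by ring
      rw [h6]; linarith
    have h7 := Real.log_le_log (by positivity) h5
    have h8 := hfg z.1 z.2
    have h9 := Real.log_le_sub_one_of_pos
      (x := mixtureDensity p g z.2 / mixtureDensity p f z.2) (by positivity)
    rw [Real.log_div (by positivity) (by positivity), Real.log_div (by positivity) (by positivity)]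
      at h7
    rw [Real.log_div (by positivity) (by positivity)] at h8 h9
    rw [Real.log_div (by positivity) (by positivity)]
    simp only [hR]
    linarith
  refine hmono.trans ?_
  have i1 : Integrable (fun z : α × β => Real.log 2 + c z.2) (jointLaw p ν) :=
    (integrable_const _).add hci'
  have i2 : Integrable (fun z : α × β => R z.2 - 1) (jointLaw p ν) := hRi.sub (integrable_const _)
  have i3 : Integrable (fun z : α × β => Real.log 2 + c z.2 + (R z.2 - 1)) (jointLaw p ν) :=
    i1.add i2
  rw [integral_add (hq.integrable_jointLaw_log_div p) i3, integral_add i1 i2,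
    integral_add (integrable_const _) hci', integral_sub hRi (integrable_const _), hRone]
  simp only [integral_const, probReal_univ, smul_eq_mul, one_mul]
  linarith

theorem IsDensityChannel.information_le_log_card (h : IsDensityChannel ρ f ν) (p : Measure α)
    [IsProbabilityMeasure p] :
    ∫ z, Real.log (f z.1 z.2 / mixtureDensity p f z.2) ∂(jointLaw p ν) ≤
      Real.log (Fintype.card α) := by
  have := h.prob
  have hfm := h.measurable_uncurry
  have hfm' := h.measurable
  refine le_trans ?_ (entropy_le_log_card p)
  rw [integral_jointLaw (F := fun z => Real.log (f z.1 z.2 / mixtureDensity p f z.2))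
    (by fun_prop) (h.integrable_log_div p), entropy]
  refine Finset.sum_le_sum fun x _ => ?_
  by_cases hx : p.real {x} = 0
  · simp [hx]
  have hx' : 0 < p.real {x} := lt_of_le_of_ne measureReal_nonneg (Ne.symm hx)
  rw [Real.negMulLog, neg_mul, ← mul_neg]
  refine mul_le_mul_of_nonneg_left ?_ measureReal_nonneg
  calc ∫ y, Real.log (f x y / mixtureDensity p f y) ∂(ν x)
      ≤ ∫ _, -Real.log (p.real {x}) ∂(ν x) := by
        refine integral_mono (h.integrable_log_div p x hx) (integrable_const _) fun y => ?_
        have h1 := h.pos x y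
        have h2 := mixtureDensity_pos p h.pos y
        have h3 := Real.log_le_log (by positivity) (le_mixtureDensity p h.pos x y)
        rw [Real.log_mul (by positivity) (by positivity)] at h3
        simp only [Real.log_div h1.ne' h2.ne']
        linarith
    _ = -Real.log (p.real {x}) := by simp

theorem IsDensityChannel.information_nonneg (h : IsDensityChannel ρ f ν) (p : Measure α)
    [IsProbabilityMeasure p] :
    0 ≤ ∫ z, Real.log (f z.1 z.2 / mixtureDensity p f z.2) ∂(jointLaw p ν) := by
  have := h.prob
  have hfm := h.measurable_uncurry
  have hfm' := h.measurable
  rw [integral_jointLaw (F := fun z => Real.log (f z.1 z.2 / mixtureDensity p f z.2))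
    (by fun_prop) (h.integrable_log_div p)]
  refine Finset.sum_nonneg fun x _ => ?_
  by_cases hx : p.real {x} = 0
  · simp [hx]
  refine mul_nonneg measureReal_nonneg ?_
  have hone : ∫ y, mixtureDensity p f y / f x y ∂(ν x) = 1 := by
    rw [integral_eq_lintegral_of_nonneg_ae
      (ae_of_all _ fun y => (div_pos (mixtureDensity_pos p h.pos y) (h.pos x y)).le)
      (by fun_prop : Measurable _).aestronglyMeasurable, h.lintegral_mixtureDensity_div p]
    simp
  calc (0 : ℝ) = ∫ y, (1 - mixtureDensity p f y / f x y) ∂(ν x) := by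
        rw [integral_sub (integrable_const _) (h.integrable_mixtureDensity_div p x), hone]
        simp
    _ ≤ ∫ y, Real.log (f x y / mixtureDensity p f y) ∂(ν x) := by
        refine integral_mono ((integrable_const _).sub (h.integrable_mixtureDensity_div p x))
          (h.integrable_log_div p x hx) fun y => ?_
        have := Real.log_le_sub_one_of_pos (div_pos (mixtureDensity_pos p h.pos y) (h.pos x y))
        rw [← inv_div, Real.log_inv] at this
        rw [← inv_div (f x y)]
        simp only
        linarith

end Information

/-! ### Densities of Markov blocks -/

section MarkovDensity

/-- The density of `(y_0, …, y_n)` when `y_0` has density `g₀` and the transition from `y_k` to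
`y_{k+1}` has density `g k (y_k)`. -/
def markovDensity (g₀ : ℝ → ℝ) (g : ℕ → ℝ → ℝ → ℝ) (n : ℕ) (y : Fin (n + 1) → ℝ) : ℝ :=
  g₀ (y 0) * ∏ k : Fin n, g k (y k.castSucc) (y k.succ)

theorem markovDensity_snoc (g₀ : ℝ → ℝ) (g : ℕ → ℝ → ℝ → ℝ) (n : ℕ) (v : Fin (n + 1) → ℝ) (a : ℝ) :
    markovDensity g₀ g (n + 1) (Fin.snoc (α := fun _ => ℝ) v a) =
      markovDensity g₀ g n v * g n (v (Fin.last n)) a := by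
  rw [markovDensity, markovDensity, Fin.prod_univ_castSucc, ← mul_assoc]
  congr 1
  · have h0 : Fin.snoc (α := fun _ => ℝ) v a 0 = v 0 := Fin.snoc_castSucc (α := fun _ => ℝ) a v 0
    rw [h0]
    congr 1
    · refine Finset.prod_congr rfl fun k _ => ?_
      rw [Fin.snoc_castSucc, ← Fin.castSucc_succ, Fin.snoc_castSucc]
      rfl
  · rw [Fin.snoc_castSucc, Fin.succ_last, Fin.snoc_last]
    rfl

theorem markovDensity_pos {g₀ : ℝ → ℝ} {g : ℕ → ℝ → ℝ → ℝ} (h₀ : ∀ a, 0 < g₀ a)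
    (h : ∀ k s a, 0 < g k s a) (n : ℕ) (y : Fin (n + 1) → ℝ) : 0 < markovDensity g₀ g n y :=
  mul_pos (h₀ _) (Finset.prod_pos fun _ _ => h _ _ _)

theorem measurable_markovDensity {g₀ : ℝ → ℝ} {g : ℕ → ℝ → ℝ → ℝ} (h₀ : Measurable g₀)
    (h : ∀ k, Measurable fun z : ℝ × ℝ => g k z.1 z.2) (n : ℕ) :
    Measurable (markovDensity g₀ g n) := by
  unfold markovDensity
  refine (h₀.comp (measurable_pi_apply 0)).mul (Finset.measurable_prod _ fun k _ => ?_)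
  exact (h k).comp (f := fun y : Fin (n + 1) → ℝ => (y k.castSucc, y k.succ))
    ((measurable_pi_apply _).prodMk (measurable_pi_apply _))

theorem measurable_snoc {n : ℕ} :
    Measurable fun z : (Fin (n + 1) → ℝ) × ℝ => (Fin.snoc (α := fun _ => ℝ) z.1 z.2) := by
  refine measurable_pi_lambda _ fun i => ?_
  refine Fin.lastCases ?_ (fun j => ?_) i
  · simpa using measurable_snd
  · simp only [Fin.snoc_castSucc]
    fun_prop

theorem lintegral_fin_succ {n : ℕ} {F : (Fin (n + 2) → ℝ) → ℝ≥0∞} (hF : Measurable F) :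
    ∫⁻ y, F y = ∫⁻ v : Fin (n + 1) → ℝ, ∫⁻ a : ℝ, F (Fin.snoc (α := fun _ => ℝ) v a) := by
  have h := volume_preserving_piFinSuccAbove (fun _ : Fin (n + 2) => ℝ) (Fin.last (n + 1))
  rw [← (h.symm _).lintegral_comp hF, Measure.volume_eq_prod,
    lintegral_prod_symm (fun z => F ((MeasurableEquiv.piFinSuccAbove (fun _ => ℝ)
      (Fin.last (n + 1))).symm z)) (hF.comp (MeasurableEquiv.measurable _)).aemeasurable]
  refine lintegral_congr fun v => lintegral_congr fun a => ?_
  rw [MeasurableEquiv.piFinSuccAbove_symm_apply]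
  simp [Fin.insertNthEquiv]

theorem lintegral_fin_one {F : (Fin 1 → ℝ) → ℝ≥0∞} :
    ∫⁻ y, F y = ∫⁻ a : ℝ, F (fun _ => a) := by
  have h := volume_preserving_funUnique (Fin 1) ℝ
  exact ((h.symm _).lintegral_comp_emb (MeasurableEquiv.measurableEmbedding _) F).symm

theorem lintegral_markovDensity {g₀ : ℝ → ℝ} {g : ℕ → ℝ → ℝ → ℝ} (h₀ : Measurable g₀)
    (h : ∀ k, Measurable fun z : ℝ × ℝ => g k z.1 z.2) (hp₀ : ∀ a, 0 < g₀ a)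
    (hp : ∀ k s a, 0 < g k s a) (h1₀ : ∫⁻ a, ENNReal.ofReal (g₀ a) = 1)
    (h1 : ∀ k s, ∫⁻ a, ENNReal.ofReal (g k s a) = 1) (n : ℕ) :
    ∫⁻ y, ENNReal.ofReal (markovDensity g₀ g n y) = 1 := by
  induction n with
  | zero => rw [lintegral_fin_one]; simpa [markovDensity] using h1₀
  | succ n ih =>
    rw [lintegral_fin_succ (measurable_markovDensity h₀ h _).ennreal_ofReal, ← ih]
    refine lintegral_congr fun v => ?_
    simp_rw [markovDensity_snoc, ENNReal.ofReal_mul (markovDensity_pos hp₀ hp n v).le]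
    have hn : Measurable fun a => g n (v (Fin.last n)) a := (h n).comp measurable_prodMk_left
    rw [lintegral_const_mul _ hn.ennreal_ofReal, h1, mul_one]

/-- A process whose one-step conditional laws have densities `g k` has blocks with density
`markovDensity g₀ g`. -/
theorem map_block_eq_withDensity {Ω : Type*} [MeasurableSpace Ω] {μ : Measure Ω}
    {Y : Ω → ℕ → ℝ} (hY : ∀ k, Measurable fun ω => Y ω k) {g₀ : ℝ → ℝ} {g : ℕ → ℝ → ℝ → ℝ}
    (h₀ : Measurable g₀) (h : ∀ k, Measurable fun z : ℝ × ℝ => g k z.1 z.2) (hp₀ : ∀ a, 0 < g₀ a)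
    (hp : ∀ k s a, 0 < g k s a)
    (hzero : ∀ F : ℝ → ℝ≥0∞, Measurable F →
      ∫⁻ ω, F (Y ω 0) ∂μ = ∫⁻ a, ENNReal.ofReal (g₀ a) * F a)
    (hsucc : ∀ n, ∀ F : (Fin (n + 1) → ℝ) → ℝ → ℝ≥0∞,
      Measurable (fun z : (Fin (n + 1) → ℝ) × ℝ => F z.1 z.2) →
      ∫⁻ ω, F (fun i => Y ω i) (Y ω (n + 1)) ∂μ =
        ∫⁻ ω, (∫⁻ a, ENNReal.ofReal (g n (Y ω n) a) * F (fun i => Y ω i) a) ∂μ) (n : ℕ) :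
    μ.map (fun ω (i : Fin (n + 1)) => Y ω i) =
      volume.withDensity (fun y => ENNReal.ofReal (markovDensity g₀ g n y)) := by
  have hm : ∀ n, Measurable fun ω => (fun i : Fin (n + 1) => Y ω i) := fun n =>
    measurable_pi_lambda _ fun i => hY i
  induction n with
  | zero =>
    refine Measure.ext_of_lintegral _ fun F hF => ?_
    rw [lintegral_map hF (hm 0), lintegral_withDensity_eq_lintegral_mul _
      (measurable_markovDensity h₀ h _).ennreal_ofReal hF, lintegral_fin_one]
    have := hzero (fun a => F fun _ => a) (by fun_prop)
    simp only [Pi.mul_apply, markovDensity]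
    rw [show (fun ω => F fun i : Fin (0 + 1) => Y ω i) = fun ω => F fun _ => Y ω 0 by
      funext ω; congr 1; funext i; rw [Fin.val_eq_zero i], this]
    simp
  | succ n ih =>
    refine Measure.ext_of_lintegral _ fun F hF => ?_
    have hmd := measurable_markovDensity h₀ h
    have hFs : Measurable fun z : (Fin (n + 1) → ℝ) × ℝ => F (Fin.snoc (α := fun _ => ℝ) z.1 z.2) :=
      hF.comp measurable_snoc
    rw [lintegral_map hF (hm _), lintegral_withDensity_eq_lintegral_mul _
      (hmd _).ennreal_ofReal hF, lintegral_fin_succ ((hmd _).ennreal_ofReal.mul hF)]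
    have h1 : ∀ ω, (fun i : Fin (n + 1 + 1) => Y ω i) =
        Fin.snoc (α := fun _ => ℝ) (fun i : Fin (n + 1) => Y ω i) (Y ω (n + 1)) := by
      intro ω
      funext i
      refine Fin.lastCases ?_ (fun j => ?_) i <;> simp
    simp_rw [h1]
    rw [hsucc n (fun v a => F (Fin.snoc (α := fun _ => ℝ) v a)) hFs]
    have hG : Measurable fun v : Fin (n + 1) → ℝ => ∫⁻ a, ENNReal.ofReal (g n (v (Fin.last n)) a) *
        F (Fin.snoc (α := fun _ => ℝ) v a) := by
      refine Measurable.lintegral_prod_right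
        (f := fun v a => ENNReal.ofReal (g n (v (Fin.last n)) a) *
          F (Fin.snoc (α := fun _ => ℝ) v a)) (Measurable.mul ?_ hFs)
      exact ((h n).comp (f := fun z : (Fin (n + 1) → ℝ) × ℝ => (z.1 (Fin.last n), z.2))
        (by fun_prop)).ennreal_ofReal
    have h2 := lintegral_map (μ := μ) hG (hm n)
    rw [ih, lintegral_withDensity_eq_lintegral_mul _ (hmd _).ennreal_ofReal hG] at h2
    simp only [Fin.val_last] at h2
    rw [← h2]
    refine lintegral_congr fun v => ?_
    simp only [Pi.mul_apply, markovDensity_snoc,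
      ENNReal.ofReal_mul (markovDensity_pos hp₀ hp n v).le, mul_assoc]
    refine (lintegral_const_mul _ (Measurable.mul ?_ ?_)).symm
    · exact ((h n).comp measurable_prodMk_left).ennreal_ofReal
    · exact hFs.comp measurable_prodMk_left

end MarkovDensity

/-! ### Resampling the coordinates of a product measure, and Gaussian smoothing -/

section Resampling

variable {ι : Type*} (m : ι → Measure ℝ) [∀ i, IsProbabilityMeasure (m i)]

theorem measurable_piecewise_pi (S : Set ι) [∀ i, Decidable (i ∈ S)] :
    Measurable fun z : (ι → ℝ) × (ι → ℝ) => S.piecewise z.1 z.2 := by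
  refine measurable_pi_lambda _ fun i => ?_
  by_cases h : i ∈ S
  · simp only [Set.piecewise, h, if_true]
    fun_prop
  · simp only [Set.piecewise, h, if_false]
    fun_prop

/-- Drawing the coordinates in `S` and those outside `S` from two independent samples of a product
measure gives a sample of that product measure. -/
theorem map_piecewise_infinitePi (S : Set ι) [∀ i, Decidable (i ∈ S)] :
    ((Measure.infinitePi m).prod (Measure.infinitePi m)).map
      (fun z => S.piecewise z.1 z.2) = Measure.infinitePi m := by
  refine Measure.eq_infinitePi _ fun s t ht => ?_
  classical
  rw [Measure.map_apply (measurable_piecewise_pi S)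
    (MeasurableSet.pi s.countable_toSet fun i _ => ht i)]
  have : (fun z : (ι → ℝ) × (ι → ℝ) => S.piecewise z.1 z.2) ⁻¹' (Set.pi s t) =
      (Set.pi (s.filter (· ∈ S) : Finset ι) t) ×ˢ (Set.pi (s.filter (· ∉ S) : Finset ι) t) := by
    ext z
    simp only [Set.mem_preimage, Set.mem_pi, Finset.mem_coe, Set.mem_prod, Finset.mem_filter]
    constructor
    · intro h
      refine ⟨fun i hi => ?_, fun i hi => ?_⟩
      · simpa [Set.piecewise, hi.2] using h i hi.1
      · simpa [Set.piecewise, hi.2] using h i hi.1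
    · rintro ⟨h1, h2⟩ i hi
      by_cases hS : i ∈ S
      · simpa [Set.piecewise, hS] using h1 i ⟨hi, hS⟩
      · simpa [Set.piecewise, hS] using h2 i ⟨hi, hS⟩
  rw [this, Measure.prod_prod, Measure.infinitePi_pi _ fun i _ => ht i,
    Measure.infinitePi_pi _ fun i _ => ht i, Finset.prod_filter_mul_prod_filter_not]

theorem lintegral_resample (S : Set ι) [∀ i, Decidable (i ∈ S)] {F : (ι → ℝ) → ℝ≥0∞}
    (hF : Measurable F) :
    ∫⁻ ζ, F ζ ∂(Measure.infinitePi m) =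
      ∫⁻ ζ₂, ∫⁻ ζ₁, F (S.piecewise ζ₁ ζ₂) ∂(Measure.infinitePi m) ∂(Measure.infinitePi m) := by
  conv_lhs => rw [← map_piecewise_infinitePi m S]
  rw [lintegral_map hF (measurable_piecewise_pi S),
    lintegral_prod_symm (fun z : (ι → ℝ) × (ι → ℝ) => F (S.piecewise z.1 z.2))
      (hF.comp (measurable_piecewise_pi S)).aemeasurable]

theorem integral_resample (S : Set ι) [∀ i, Decidable (i ∈ S)] {F : (ι → ℝ) → ℝ}
    (hFm : Measurable F) (hF : Integrable F (Measure.infinitePi m)) :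
    ∫ ζ, F ζ ∂(Measure.infinitePi m) =
      ∫ ζ₂, ∫ ζ₁, F (S.piecewise ζ₁ ζ₂) ∂(Measure.infinitePi m) ∂(Measure.infinitePi m) := by
  conv_lhs => rw [← map_piecewise_infinitePi m S]
  rw [integral_map (measurable_piecewise_pi S).aemeasurable hFm.aestronglyMeasurable,
    integral_prod_symm]
  rw [← map_piecewise_infinitePi m S] at hF
  exact hF.comp_measurable (measurable_piecewise_pi S)

theorem lintegral_coord {i : ι} {F : ℝ → ℝ≥0∞} (hF : Measurable F) :
    ∫⁻ ζ, F (ζ i) ∂(Measure.infinitePi m) = ∫⁻ a, F a ∂(m i) := by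
  rw [← Measure.infinitePi_map_eval m i, lintegral_map hF (measurable_pi_apply i)]

/-- A function of the coordinate `i` is independent of a function of the other coordinates. -/
theorem lintegral_mul_coord {i : ι} {F : ℝ → ℝ≥0∞} (hF : Measurable F) {G : (ι → ℝ) → ℝ≥0∞}
    (hG : Measurable G) (hGi : ∀ ζ ζ' : ι → ℝ, (∀ j, j ≠ i → ζ j = ζ' j) → G ζ = G ζ') :
    ∫⁻ ζ, F (ζ i) * G ζ ∂(Measure.infinitePi m) =
      (∫⁻ a, F a ∂(m i)) * ∫⁻ ζ, G ζ ∂(Measure.infinitePi m) := by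
  classical
  rw [lintegral_resample m {i} (by fun_prop), ← lintegral_const_mul _ hG]
  refine lintegral_congr fun ζ₂ => ?_
  have : ∀ ζ₁, F (({i} : Set ι).piecewise ζ₁ ζ₂ i) * G (({i} : Set ι).piecewise ζ₁ ζ₂) =
      F (ζ₁ i) * G ζ₂ := by
    intro ζ₁
    rw [hGi _ ζ₂ fun j hj => by simp [Set.piecewise, hj]]
    simp [Set.piecewise]
  simp_rw [this]
  rw [lintegral_mul_const _ (by fun_prop), lintegral_coord m hF]

end Resampling

section GaussianSmoothing

variable {Ω : Type*} [MeasurableSpace Ω] (μ : Measure Ω) [IsProbabilityMeasure μ]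

/-- The density at `a` of `c + W`, where `W` is a standard Gaussian variable independent of `c`. -/
noncomputable def smoothedDensity (c : Ω → ℝ) (a : ℝ) : ℝ :=
  ∫ ω, gaussianPDFReal 0 1 (a - c ω) ∂μ

theorem gaussianPDFReal_le_one (a : ℝ) : gaussianPDFReal 0 1 a ≤ 1 := by
  rw [gaussianPDFReal]
  have h1 : (√(2 * Real.pi * ((1 : ℝ≥0) : ℝ)))⁻¹ ≤ 1 := by
    apply inv_le_one_of_one_le₀
    rw [Real.one_le_sqrt]
    simp only [NNReal.coe_one, mul_one]
    linarith [Real.pi_gt_three]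
  have h2 : Real.exp (-(a - 0) ^ 2 / (2 * ((1 : ℝ≥0) : ℝ))) ≤ 1 := by
    rw [Real.exp_le_one_iff]
    simp only [NNReal.coe_one, mul_one]
    nlinarith [sq_nonneg (a - 0)]
  exact mul_le_one₀ h1 (Real.exp_nonneg _) h2

theorem integrable_gaussianPDFReal_sub {c : Ω → ℝ} (hc : Measurable c) (a : ℝ) :
    Integrable (fun ω => gaussianPDFReal 0 1 (a - c ω)) μ :=
  Integrable.of_bound ((measurable_gaussianPDFReal 0 1).comp
    (measurable_const.sub hc)).aestronglyMeasurable 1 (ae_of_all _ fun ω => by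
      rw [Real.norm_of_nonneg (gaussianPDFReal_nonneg _ _ _)]
      exact gaussianPDFReal_le_one _)

theorem ofReal_smoothedDensity {c : Ω → ℝ} (hc : Measurable c) (a : ℝ) :
    ENNReal.ofReal (smoothedDensity μ c a) = ∫⁻ ω, gaussianPDF 0 1 (a - c ω) ∂μ := by
  rw [smoothedDensity, ofReal_integral_eq_lintegral_ofReal (integrable_gaussianPDFReal_sub μ hc a)
    (ae_of_all _ fun ω => gaussianPDFReal_nonneg _ _ _)]
  rfl

theorem smoothedDensity_pos {c : Ω → ℝ} (hc : Measurable c) (a : ℝ) :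
    0 < smoothedDensity μ c a := by
  rw [smoothedDensity, integral_pos_iff_support_of_nonneg
    (fun ω => gaussianPDFReal_nonneg _ _ _) (integrable_gaussianPDFReal_sub μ hc a)]
  have : Function.support (fun ω => gaussianPDFReal 0 1 (a - c ω)) = Set.univ := by
    ext ω
    simp [(gaussianPDFReal_pos 0 1 (a - c ω) one_ne_zero).ne']
  rw [this, measure_univ]
  exact one_pos

theorem smoothedDensity_le_one {c : Ω → ℝ} (hc : Measurable c) (a : ℝ) :
    smoothedDensity μ c a ≤ 1 := by
  calc smoothedDensity μ c a ≤ ∫ _, (1 : ℝ) ∂μ :=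
        integral_mono (integrable_gaussianPDFReal_sub μ hc a) (integrable_const _)
          fun ω => gaussianPDFReal_le_one _
    _ = 1 := by simp

theorem measurable_smoothedDensity {c : ℝ → Ω → ℝ}
    (hc : Measurable fun z : ℝ × Ω => c z.1 z.2) :
    Measurable fun z : ℝ × ℝ => smoothedDensity μ (c z.1) z.2 := by
  refine StronglyMeasurable.measurable ?_
  refine StronglyMeasurable.integral_prod_right
    (f := fun (z : ℝ × ℝ) ω => gaussianPDFReal 0 1 (z.2 - c z.1 ω)) ?_
  refine ((measurable_gaussianPDFReal 0 1).comp ?_).stronglyMeasurable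
  exact (measurable_snd.comp measurable_fst).sub
    (hc.comp ((measurable_fst.comp measurable_fst).prodMk measurable_snd))

theorem lintegral_gaussianReal_add (c : ℝ) {F : ℝ → ℝ≥0∞} (hF : Measurable F) :
    ∫⁻ w, F (c + w) ∂(gaussianReal 0 1) = ∫⁻ a, gaussianPDF 0 1 (a - c) * F a := by
  rw [gaussianReal_of_var_ne_zero _ one_ne_zero, lintegral_withDensity_eq_lintegral_mul _
    (measurable_gaussianPDF 0 1) (by fun_prop),
    ← lintegral_add_left_eq_self (fun a => gaussianPDF 0 1 (a - c) * F a) c]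
  refine lintegral_congr fun a => ?_
  simp

theorem lintegral_smoothedDensity_mul {c : Ω → ℝ} (hc : Measurable c) {F : ℝ → ℝ≥0∞}
    (hF : Measurable F) :
    ∫⁻ a, ENNReal.ofReal (smoothedDensity μ c a) * F a =
      ∫⁻ ω, ∫⁻ w, F (c ω + w) ∂(gaussianReal 0 1) ∂μ := by
  have hm : Measurable fun z : ℝ × Ω => gaussianPDF 0 1 (z.1 - c z.2) :=
    (measurable_gaussianPDF 0 1).comp (measurable_fst.sub (hc.comp measurable_snd))
  simp_rw [ofReal_smoothedDensity μ hc, lintegral_gaussianReal_add _ hF]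
  rw [lintegral_lintegral_swap
    ((hm.comp (measurable_snd.prodMk measurable_fst)).mul
      (hF.comp measurable_snd)).aemeasurable]
  refine lintegral_congr fun a => ?_
  exact (lintegral_mul_const _ (hm.comp measurable_prodMk_left)).symm

theorem lintegral_smoothedDensity {c : Ω → ℝ} (hc : Measurable c) :
    ∫⁻ a, ENNReal.ofReal (smoothedDensity μ c a) = 1 := by
  simpa using lintegral_smoothedDensity_mul μ hc (F := fun _ => 1) measurable_const

end GaussianSmoothing

/-! ### The channel on the canonical noise space -/

section CanonicalChannel

/-- The channel output driven by a point `ζ` of the canonical noise space: `ζ (j, i)` is the value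
at time `i` of the `j`-th of the five noise processes `A, B, E, W, U`. -/
def chan (x : ℕ → ℝ) (ζ : Fin 5 × ℕ → ℝ) : ℕ → ℝ :=
  output (fun i ζ => ζ (0, i)) (fun i ζ => ζ (1, i)) (fun i ζ => ζ (2, i)) (fun i ζ => ζ (3, i))
    (fun i (ζ : Fin 5 × ℕ → ℝ) => ζ (4, i)) x ζ

/-- The part of the output at time `k + 1` that does not involve `W (k + 1)`, given that the output
at time `k` is `s`. -/
def drift (x : ℕ → ℝ) (k : ℕ) (s : ℝ) (ζ : Fin 5 × ℕ → ℝ) : ℝ :=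
  x (k + 1) + ζ (0, k + 1) * x k + ζ (1, k + 1) * (s - ζ (2, k)) + ζ (4, k + 1)

theorem chan_zero (x : ℕ → ℝ) (ζ : Fin 5 × ℕ → ℝ) : chan x ζ 0 = x 0 + ζ (4, 0) + ζ (3, 0) := by
  rw [chan, output]; ring

theorem chan_succ (x : ℕ → ℝ) (ζ : Fin 5 × ℕ → ℝ) (k : ℕ) :
    chan x ζ (k + 1) = drift x k (chan x ζ k) ζ + ζ (3, k + 1) := by
  rw [chan, output, drift]; ring

theorem output_eq_chan {Ω : Type*} (A B E W U : ℕ → Ω → ℝ) (x : ℕ → ℝ) (ω : Ω) (k : ℕ) :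
    output A B E W U x ω k =
      chan x (fun q => (![A, B, E, W, U] : Fin 5 → ℕ → Ω → ℝ) q.1 q.2 ω) k := by
  induction k with
  | zero => rw [chan_zero, output]; simp; ring
  | succ k ih => rw [chan_succ, output, ← ih, drift]; simp; ring

/-- The output at time `k` depends on the inputs up to time `k`, on the noise `E` before time `k`
and on the other noises up to time `k`. -/
theorem chan_congr {x x' : ℕ → ℝ} {ζ ζ' : Fin 5 × ℕ → ℝ} {k : ℕ} (hx : ∀ i ≤ k, x i = x' i)
    (h2 : ∀ i < k, ζ (2, i) = ζ' (2, i)) (h : ∀ j ≠ 2, ∀ i ≤ k, ζ (j, i) = ζ' (j, i)) :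
    chan x ζ k = chan x' ζ' k := by
  induction k with
  | zero =>
    rw [chan_zero, chan_zero, hx 0 le_rfl, h 4 (by decide) 0 le_rfl, h 3 (by decide) 0 le_rfl]
  | succ k ih =>
    rw [chan_succ, chan_succ, ih (fun i hi => hx i (by omega)) (fun i hi => h2 i (by omega))
      (fun j hj i hi => h j hj i (by omega)), drift, drift, hx _ le_rfl, hx k (by omega),
      h2 k (by omega), h 0 (by decide) _ le_rfl, h 1 (by decide) _ le_rfl,
      h 4 (by decide) _ le_rfl, h 3 (by decide) _ le_rfl]

@[fun_prop]
theorem measurable_chan (x : ℕ → ℝ) (k : ℕ) : Measurable fun ζ => chan x ζ k := by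
  induction k with
  | zero => simp_rw [chan_zero]; fun_prop
  | succ k ih => simp_rw [chan_succ, drift]; fun_prop

theorem measurable_drift (x : ℕ → ℝ) (k : ℕ) :
    Measurable fun z : ℝ × (Fin 5 × ℕ → ℝ) => drift x k z.1 z.2 := by
  unfold drift
  fun_prop

theorem measurable_drift_right (x : ℕ → ℝ) (k : ℕ) (s : ℝ) : Measurable (drift x k s) := by
  unfold drift
  fun_prop

variable (m : Fin 5 → Measure ℝ) [∀ j, IsProbabilityMeasure (m j)]

/-- The law of the noise: all coordinates are independent, and the `j`-th process is identically
distributed with law `m j`. -/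
noncomputable def noiseLaw : Measure (Fin 5 × ℕ → ℝ) := Measure.infinitePi fun q => m q.1

instance : IsProbabilityMeasure (noiseLaw m) := by unfold noiseLaw; infer_instance

/-- A quantity `c` that does not involve `W k` is independent of `W k`. -/
theorem lintegral_noiseLaw_add (hm : m 3 = gaussianReal 0 1) {k : ℕ} {c : (Fin 5 × ℕ → ℝ) → ℝ}
    (hc : Measurable c)
    (hck : ∀ ζ ζ' : Fin 5 × ℕ → ℝ, (∀ j, j ≠ (3, k) → ζ j = ζ' j) → c ζ = c ζ')
    {F : ℝ → ℝ≥0∞} (hF : Measurable F) :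
    ∫⁻ ζ, F (c ζ + ζ (3, k)) ∂(noiseLaw m) =
      ∫⁻ ζ, ∫⁻ w, F (c ζ + w) ∂(gaussianReal 0 1) ∂(noiseLaw m) := by
  classical
  rw [noiseLaw, lintegral_resample _ {(3, k)} (by fun_prop)]
  refine lintegral_congr fun ζ₂ => ?_
  have : ∀ ζ₁, F (c (({(3, k)} : Set (Fin 5 × ℕ)).piecewise ζ₁ ζ₂) +
      ({(3, k)} : Set (Fin 5 × ℕ)).piecewise ζ₁ ζ₂ (3, k)) = F (c ζ₂ + ζ₁ (3, k)) := by
    intro ζ₁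
    rw [hck _ ζ₂ fun j hj => by simp [Set.piecewise, hj]]
    simp [Set.piecewise]
  simp_rw [this]
  rw [lintegral_coord (fun q : Fin 5 × ℕ => m q.1) (F := fun w => F (c ζ₂ + w)) (by fun_prop), hm]

/-- The transition density of the output from time `k` to time `k + 1` for the input `x`. -/
noncomputable def transDensity (x : ℕ → ℝ) (k : ℕ) (s a : ℝ) : ℝ :=
  smoothedDensity (noiseLaw m) (drift x k s) a

/-- The density of the output at time `0` for the input `x`. -/
noncomputable def initDensity (x : ℕ → ℝ) (a : ℝ) : ℝ :=
  smoothedDensity (noiseLaw m) (fun ζ => x 0 + ζ (4, 0)) a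

theorem measurable_transDensity (x : ℕ → ℝ) (k : ℕ) :
    Measurable fun z : ℝ × ℝ => transDensity m x k z.1 z.2 :=
  measurable_smoothedDensity (noiseLaw m) (measurable_drift x k)

theorem measurable_initDensity (x : ℕ → ℝ) : Measurable (initDensity m x) := by
  have hc : Measurable fun z : ℝ × (Fin 5 × ℕ → ℝ) => x 0 + z.2 (4, 0) := by fun_prop
  have h := measurable_smoothedDensity (noiseLaw m) (c := fun _ ζ => x 0 + ζ (4, 0)) hc
  generalize hg : smoothedDensity (noiseLaw m) (fun ζ => x 0 + ζ (4, 0)) = g at h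
  have h' : initDensity m x = g := hg
  rw [h']
  exact h.comp (measurable_prodMk_left (x := (0 : ℝ)))

theorem transDensity_pos (x : ℕ → ℝ) (k : ℕ) (s a : ℝ) : 0 < transDensity m x k s a :=
  smoothedDensity_pos _ (measurable_drift_right x k s) a

theorem initDensity_pos (x : ℕ → ℝ) (a : ℝ) : 0 < initDensity m x a :=
  smoothedDensity_pos _ (by fun_prop) a

/-- The density of the output block of length `n + 1` for the input `x`. -/
noncomputable def chanDensity (x : ℕ → ℝ) (n : ℕ) : (Fin (n + 1) → ℝ) → ℝ :=
  markovDensity (initDensity m x) (transDensity m x) n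

theorem measurable_chanDensity (x : ℕ → ℝ) (n : ℕ) : Measurable (chanDensity m x n) :=
  measurable_markovDensity (measurable_initDensity m x) (measurable_transDensity m x) n

theorem chanDensity_pos (x : ℕ → ℝ) (n : ℕ) (y : Fin (n + 1) → ℝ) : 0 < chanDensity m x n y :=
  markovDensity_pos (initDensity_pos m x) (transDensity_pos m x) n y

theorem measurable_chan_block (x : ℕ → ℝ) (n : ℕ) :
    Measurable fun ζ (i : Fin (n + 1)) => chan x ζ i :=
  measurable_pi_lambda _ fun i => measurable_chan x i

theorem map_chan_block (hm : m 3 = gaussianReal 0 1) (x : ℕ → ℝ) (n : ℕ) :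
    (noiseLaw m).map (fun ζ (i : Fin (n + 1)) => chan x ζ i) =
      volume.withDensity (fun y => ENNReal.ofReal (chanDensity m x n y)) := by
  classical
  refine map_block_eq_withDensity (Y := chan x) (measurable_chan x) (measurable_initDensity m x)
    (measurable_transDensity m x) (initDensity_pos m x) (transDensity_pos m x) ?_ ?_ n
  · intro F hF
    simp_rw [initDensity, chan_zero]
    rw [lintegral_smoothedDensity_mul _ (by fun_prop) hF,
      lintegral_noiseLaw_add m hm (c := fun ζ => x 0 + ζ (4, 0)) (by fun_prop) ?_ hF]
    intro ζ ζ' h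
    rw [h (4, 0) (by simp)]
  · intro n F hF
    have hv : ∀ v, Measurable (F v) := fun v => hF.comp measurable_prodMk_left
    simp_rw [transDensity, fun ζ => lintegral_smoothedDensity_mul (noiseLaw m)
      (measurable_drift_right x n (chan x ζ n)) (hv fun i : Fin (n + 1) => chan x ζ i)]
    have h1 : ∀ ζ : Fin 5 × ℕ → ℝ,
        ∫⁻ ω, ∫⁻ w, F (fun i => chan x ζ i) (drift x n (chan x ζ n) ω + w)
          ∂(gaussianReal 0 1) ∂(noiseLaw m) =
        ∫⁻ ω, F (fun i => chan x ζ i) (drift x n (chan x ζ n) ω + ω (3, n + 1))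
          ∂(noiseLaw m) := by
      intro ζ
      refine (lintegral_noiseLaw_add m hm (measurable_drift_right x n _) ?_ (hv _)).symm
      intro ω ω' h
      simp only [drift]
      rw [h (0, n + 1) (by simp), h (1, n + 1) (by simp), h (2, n) (by simp),
        h (4, n + 1) (by simp)]
    simp_rw [h1]
    -- the noise that enters the output between the times `n` and `n + 1`; it includes `E n`, which
    -- does not affect the outputs up to time `n`
    let S : Set (Fin 5 × ℕ) := {q | (q.1 = 2 ∧ q.2 = n) ∨ (q.1 ≠ 2 ∧ q.2 = n + 1)}
    have hmeas : Measurable fun ζ => F (fun i : Fin (n + 1) => chan x ζ i) (chan x ζ (n + 1)) :=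
      hF.comp ((measurable_chan_block x n).prodMk (measurable_chan x (n + 1)))
    conv_lhs => rw [noiseLaw, lintegral_resample _ S hmeas]
    refine lintegral_congr fun ζ₂ => lintegral_congr fun ζ₁ => ?_
    have hpast : ∀ k ≤ n, chan x (S.piecewise ζ₁ ζ₂) k = chan x ζ₂ k := by
      intro k hk
      refine chan_congr (fun _ _ => rfl) (fun i hi => ?_) (fun j hj i hi => ?_)
      · refine Set.piecewise_eq_of_notMem _ _ _ ?_
        rintro (h | h)
        · omega
        · exact h.1 rfl
      · refine Set.piecewise_eq_of_notMem _ _ _ ?_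
        rintro (h | h)
        · exact hj h.1
        · omega
    have hS : ∀ q ∈ S, S.piecewise ζ₁ ζ₂ q = ζ₁ q := fun q hq =>
      Set.piecewise_eq_of_mem _ _ _ hq
    congr 1
    · funext i
      exact hpast i (by omega)
    · rw [chan_succ, hpast n le_rfl, drift, drift, hS (0, n + 1) (by simp [S]),
        hS (1, n + 1) (by simp [S]), hS (2, n) (by simp [S]), hS (3, n + 1) (by simp [S]),
        hS (4, n + 1) (by simp [S])]

end CanonicalChannel

section Moments

variable (m : Fin 5 → Measure ℝ) [∀ j, IsProbabilityMeasure (m j)]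

theorem lintegral_enorm_coord (j : Fin 5) (i : ℕ) :
    ∫⁻ ζ, ‖ζ (j, i)‖ₑ ∂(noiseLaw m) = ∫⁻ a, ‖a‖ₑ ∂(m j) :=
  lintegral_coord (fun q : Fin 5 × ℕ => m q.1) (i := (j, i)) (F := fun a => ‖a‖ₑ) (by fun_prop)

/-- Since `E|B| < 1`, the recursion `E|Y (k + 1)| ≤ C + E|B| * E|Y k|` keeps the first absolute
moments of the outputs bounded, uniformly in time and over inputs with bounded letters. -/
theorem exists_forall_lintegral_enorm_chan_le (hfin : ∀ j, ∫⁻ a, ‖a‖ₑ ∂(m j) ≠ ∞)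
    (hB : ∫⁻ a, ‖a‖ₑ ∂(m 1) < 1) (X : ℝ≥0) :
    ∃ L : ℝ≥0, ∀ x : ℕ → ℝ, (∀ i, ‖x i‖ₑ ≤ X) → ∀ k,
      ∫⁻ ζ, ‖chan x ζ k‖ₑ ∂(noiseLaw m) ≤ L := by
  lift (fun j => ∫⁻ a, ‖a‖ₑ ∂(m j)) to Fin 5 → ℝ≥0 using hfin with e he'
  have he : ∀ j, (e j : ℝ≥0∞) = ∫⁻ a, ‖a‖ₑ ∂(m j) := fun j => congrFun he' j
  have hb : e 1 < 1 := by rw [← he] at hB; exact_mod_cast hB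
  set C : ℝ≥0 := X + e 0 * X + e 1 * e 2 + e 3 + e 4 with hC
  have hL : C + e 1 * (C / (1 - e 1)) = C / (1 - e 1) := by
    have h1 : 1 - e 1 ≠ 0 := (tsub_pos_of_lt hb).ne'
    rw [← NNReal.coe_inj]
    have h2 : ((1 - e 1 : ℝ≥0) : ℝ) = 1 - e 1 := by rw [NNReal.coe_sub hb.le]; rfl
    have h3 : (1 : ℝ) - e 1 ≠ 0 := by rw [← h2]; exact_mod_cast h1
    push_cast
    rw [h2]
    field_simp
    ring
  refine ⟨C / (1 - e 1), fun x hx k => ?_⟩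
  have hCL : C ≤ C / (1 - e 1) := by
    calc C ≤ C + e 1 * (C / (1 - e 1)) := le_self_add
      _ = _ := hL
  induction k with
  | zero =>
    calc ∫⁻ ζ, ‖chan x ζ 0‖ₑ ∂(noiseLaw m)
        ≤ ∫⁻ ζ, (X + ‖ζ (4, 0)‖ₑ + ‖ζ (3, 0)‖ₑ) ∂(noiseLaw m) := by
          refine lintegral_mono fun ζ => ?_
          rw [chan_zero]
          refine (enorm_add_le _ _).trans (add_le_add_left ((enorm_add_le _ _).trans ?_) _)
          exact add_le_add_left (hx 0) _
      _ = X + e 4 + e 3 := by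
          rw [lintegral_add_right _ (by fun_prop), lintegral_add_right _ (by fun_prop),
            lintegral_enorm_coord, lintegral_enorm_coord, he, he]
          simp
      _ ≤ ((C : ℝ≥0) : ℝ≥0∞) := by
          have : X + e 4 + e 3 ≤ C := by
            rw [hC, ← NNReal.coe_le_coe]
            push_cast
            have h1 : (0 : ℝ) ≤ e 0 * X := by positivity
            have h2 : (0 : ℝ) ≤ e 1 * e 2 := by positivity
            linarith
          exact_mod_cast this
      _ ≤ _ := by exact_mod_cast hCL
  | succ k ih =>
    calc ∫⁻ ζ, ‖chan x ζ (k + 1)‖ₑ ∂(noiseLaw m)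
        ≤ ∫⁻ ζ, (X + ‖ζ (0, k + 1)‖ₑ * X + ‖ζ (1, k + 1)‖ₑ * (‖chan x ζ k‖ₑ + ‖ζ (2, k)‖ₑ)
            + ‖ζ (4, k + 1)‖ₑ + ‖ζ (3, k + 1)‖ₑ) ∂(noiseLaw m) := by
          refine lintegral_mono fun ζ => ?_
          rw [chan_succ, drift]
          refine (enorm_add_le _ _).trans (add_le_add_left ((enorm_add_le _ _).trans
            (add_le_add_left ((enorm_add_le _ _).trans (add_le_add ((enorm_add_le _ _).trans
              (add_le_add (hx _) ?_)) ?_)) _)) _)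
          · rw [enorm_mul]; exact mul_le_mul_right (hx k) _
          · rw [enorm_mul]; exact mul_le_mul_right (enorm_sub_le) _
      _ = X + e 0 * X + e 1 * (∫⁻ ζ, ‖chan x ζ k‖ₑ ∂(noiseLaw m) + e 2) + e 4 + e 3 := by
          have hind : ∫⁻ ζ, ‖ζ (1, k + 1)‖ₑ * (‖chan x ζ k‖ₑ + ‖ζ (2, k)‖ₑ) ∂(noiseLaw m) =
              (∫⁻ a, ‖a‖ₑ ∂(m 1)) * ∫⁻ ζ, (‖chan x ζ k‖ₑ + ‖ζ (2, k)‖ₑ) ∂(noiseLaw m) := by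
            refine lintegral_mul_coord (fun q : Fin 5 × ℕ => m q.1) (i := (1, k + 1))
              (F := fun a => ‖a‖ₑ) (by fun_prop) (by fun_prop) fun ζ ζ' h => ?_
            rw [h (2, k) (by simp), chan_congr (fun _ _ => rfl) (fun i hi => h _ (by simp))
              (fun j hj i hi => h _ (by simp; omega))]
          rw [lintegral_add_right _ (by fun_prop), lintegral_add_right _ (by fun_prop),
            lintegral_add_right _ (by fun_prop), lintegral_add_right _ (by fun_prop),
            lintegral_mul_const _ (by fun_prop), hind, lintegral_add_right _ (by fun_prop)]
          simp_rw [lintegral_enorm_coord, ← he]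
          simp
      _ ≤ X + e 0 * X + e 1 * ((C / (1 - e 1) : ℝ≥0) + e 2) + e 4 + e 3 := by gcongr
      _ = ((C + e 1 * (C / (1 - e 1)) : ℝ≥0) : ℝ≥0∞) := by
          rw [hC]; push_cast; ring
      _ = _ := by rw [hL]

end Moments

/-! ### Forgetting the initial state -/

section TotalVariation

theorem hasDerivAt_gaussianPDFReal_sub (a t : ℝ) :
    HasDerivAt (fun t => gaussianPDFReal 0 1 (a - t)) ((a - t) * gaussianPDFReal 0 1 (a - t)) t := by
  simp only [gaussianPDFReal_def]
  have h1 : HasDerivAt (fun t => -(a - t - 0) ^ 2 / (2 * ((1 : ℝ≥0) : ℝ))) (a - t) t := by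
    have h2 := ((((hasDerivAt_id t).const_sub a).sub_const 0).pow 2).neg.div_const
      (2 * ((1 : ℝ≥0) : ℝ))
    convert! h2 using 1
    simp
  convert! (h1.exp.const_mul (√(2 * Real.pi * ((1 : ℝ≥0) : ℝ)))⁻¹) using 1
  ring

theorem lintegral_enorm_gaussianReal :
    ∫⁻ w, ‖w‖ₑ ∂(gaussianReal 0 1) = ∫⁻ u : ℝ, ‖u * gaussianPDFReal 0 1 u‖ₑ := by
  rw [gaussianReal_of_var_ne_zero _ one_ne_zero, lintegral_withDensity_eq_lintegral_mul _
    (measurable_gaussianPDF 0 1) (by fun_prop)]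
  refine lintegral_congr fun u => ?_
  rw [Pi.mul_apply, enorm_mul, mul_comm, gaussianPDF, ← Real.enorm_of_nonneg
    (gaussianPDFReal_nonneg _ _ _)]

/-- The `L¹` distance between two translates of the standard Gaussian density is at most
`E|W|` times the distance of the means, by the mean value formula. -/
theorem lintegral_enorm_gaussianPDFReal_sub_sub_le (c c' : ℝ) :
    ∫⁻ a, ‖gaussianPDFReal 0 1 (a - c) - gaussianPDFReal 0 1 (a - c')‖ₑ ≤
      (∫⁻ w, ‖w‖ₑ ∂(gaussianReal 0 1)) * ‖c - c'‖ₑ := by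
  have hcont : Continuous (gaussianPDFReal 0 1) := by
    rw [gaussianPDFReal_def]; fun_prop
  have hmeas : Measurable fun z : ℝ × ℝ => ‖(z.1 - z.2) * gaussianPDFReal 0 1 (z.1 - z.2)‖ₑ := by
    have : Continuous fun z : ℝ × ℝ => (z.1 - z.2) * gaussianPDFReal 0 1 (z.1 - z.2) := by fun_prop
    exact this.measurable.enorm
  calc ∫⁻ a, ‖gaussianPDFReal 0 1 (a - c) - gaussianPDFReal 0 1 (a - c')‖ₑ
      ≤ ∫⁻ a, ∫⁻ t in Set.uIoc c' c, ‖(a - t) * gaussianPDFReal 0 1 (a - t)‖ₑ := by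
        refine lintegral_mono fun a => ?_
        rw [← intervalIntegral.integral_eq_sub_of_hasDerivAt
          (fun t _ => hasDerivAt_gaussianPDFReal_sub a t)
          (Continuous.intervalIntegrable (by fun_prop) _ _), ← ofReal_norm,
          intervalIntegral.norm_intervalIntegral_eq, ofReal_norm]
        exact enorm_integral_le_lintegral_enorm _
    _ = ∫⁻ t in Set.uIoc c' c, ∫⁻ a, ‖(a - t) * gaussianPDFReal 0 1 (a - t)‖ₑ :=
        lintegral_lintegral_swap hmeas.aemeasurable
    _ = ∫⁻ _ in Set.uIoc c' c, ∫⁻ w, ‖w‖ₑ ∂(gaussianReal 0 1) := by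
        refine lintegral_congr fun t => ?_
        rw [lintegral_enorm_gaussianReal]
        exact lintegral_sub_right_eq_self (fun u => ‖u * gaussianPDFReal 0 1 u‖ₑ) t
    _ = _ := by
        rw [setLIntegral_const, Real.volume_uIoc, ← Real.enorm_eq_ofReal_abs]

theorem integral_gaussianReal_add (c : ℝ) (H : ℝ → ℝ) :
    ∫ w, H (c + w) ∂(gaussianReal 0 1) = ∫ a, gaussianPDFReal 0 1 (a - c) * H a := by
  rw [integral_gaussianReal_eq_integral_smul one_ne_zero,
    ← integral_add_left_eq_self (fun a => gaussianPDFReal 0 1 (a - c) * H a) c]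
  simp

theorem enorm_integral_gaussianReal_add_sub_le {H : ℝ → ℝ} (hH : Measurable H) {M : ℝ}
    (hM : ∀ a, |H a| ≤ M) (c c' : ℝ) :
    ‖∫ w, H (c + w) ∂(gaussianReal 0 1) - ∫ w, H (c' + w) ∂(gaussianReal 0 1)‖ₑ ≤
      ENNReal.ofReal M * (∫⁻ w, ‖w‖ₑ ∂(gaussianReal 0 1)) * ‖c - c'‖ₑ := by
  have hi : ∀ c, Integrable fun a => gaussianPDFReal 0 1 (a - c) * H a := fun c =>
    ((integrable_gaussianPDFReal 0 1).comp_sub_right c).mul_bdd hH.aestronglyMeasurable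
      (ae_of_all _ hM)
  rw [integral_gaussianReal_add, integral_gaussianReal_add, ← integral_sub (hi c) (hi c')]
  calc _ ≤ ∫⁻ a, ‖gaussianPDFReal 0 1 (a - c) * H a - gaussianPDFReal 0 1 (a - c') * H a‖ₑ :=
        enorm_integral_le_lintegral_enorm _
    _ ≤ ∫⁻ a, ENNReal.ofReal M *
          ‖gaussianPDFReal 0 1 (a - c) - gaussianPDFReal 0 1 (a - c')‖ₑ := by
        refine lintegral_mono fun a => ?_
        rw [← sub_mul, enorm_mul, mul_comm]
        refine mul_le_mul_left ?_ _
        rw [Real.enorm_eq_ofReal_abs]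
        exact ENNReal.ofReal_le_ofReal (hM a)
    _ = ENNReal.ofReal M *
          ∫⁻ a, ‖gaussianPDFReal 0 1 (a - c) - gaussianPDFReal 0 1 (a - c')‖ₑ :=
        lintegral_const_mul' _ _ ENNReal.ofReal_ne_top
    _ ≤ _ := by
        rw [mul_assoc]
        exact mul_le_mul_right (lintegral_enorm_gaussianPDFReal_sub_sub_le c c') _

end TotalVariation

section Forgetting

/-- The noise seen from time `s` on. -/
def shiftNoise (s : ℕ) (ζ : Fin 5 × ℕ → ℝ) : Fin 5 × ℕ → ℝ := fun q => ζ (q.1, q.2 + s)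

/-- The channel outputs at the times `N, N + 1, …` when the output at time `N` is `a`. -/
def chanFrom (x : ℕ → ℝ) (ζ : Fin 5 × ℕ → ℝ) (N : ℕ) (a : ℝ) : ℕ → ℝ
  | 0 => a
  | j + 1 => drift x (N + j) (chanFrom x ζ N a j) ζ + ζ (3, N + j + 1)

theorem eq_chanFrom {x y : ℕ → ℝ} {ζ : Fin 5 × ℕ → ℝ}
    (hy : ∀ k, y (k + 1) = drift x k (y k) ζ + ζ (3, k + 1)) (N j : ℕ) :
    y (N + j) = chanFrom x ζ N (y N) j := by
  induction j with
  | zero => rfl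
  | succ j ih => rw [← add_assoc, hy, ih, chanFrom]

theorem chan_add_succ (x : ℕ → ℝ) (ζ : Fin 5 × ℕ → ℝ) (s k : ℕ) :
    chan x ζ (k + 1 + s) = drift (fun i => x (i + s)) k (chan x ζ (k + s)) (shiftNoise s ζ) +
      shiftNoise s ζ (3, k + 1) := by
  rw [Nat.add_right_comm, chan_succ, drift, drift]
  simp only [shiftNoise]
  rw [Nat.add_right_comm k 1 s]

theorem measurable_shiftNoise (s : ℕ) : Measurable (shiftNoise s) := by
  unfold shiftNoise
  fun_prop

theorem measurable_chanFrom (x : ℕ → ℝ) (N j : ℕ) :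
    Measurable fun z : ℝ × (Fin 5 × ℕ → ℝ) => chanFrom x z.2 N z.1 j := by
  induction j with
  | zero => simp only [chanFrom]; fun_prop
  | succ j ih => simp only [chanFrom, drift]; fun_prop

theorem chanFrom_congr (x : ℕ → ℝ) {ζ ζ' : Fin 5 × ℕ → ℝ} {N : ℕ}
    (h : ∀ q, q ≠ (3, N) → ζ q = ζ' q) (a : ℝ) (j : ℕ) :
    chanFrom x ζ N a j = chanFrom x ζ' N a j := by
  induction j with
  | zero => rfl
  | succ j ih =>
    rw [chanFrom, chanFrom, ih, drift, drift, h (0, _) (by simp), h (1, _) (by simp),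
      h (2, _) (by simp), h (4, _) (by simp), h (3, N + j + 1) (by simp; omega)]

variable (m : Fin 5 → Measure ℝ) [∀ j, IsProbabilityMeasure (m j)]

theorem map_shiftNoise (s : ℕ) : (noiseLaw m).map (shiftNoise s) = noiseLaw m := by
  have hf : Function.Injective fun q : Fin 5 × ℕ => (q.1, q.2 + s) := by
    rintro ⟨a, b⟩ ⟨a', b'⟩ h
    simp only [Prod.mk.injEq, add_left_inj] at h
    exact Prod.ext h.1 h.2
  exact Measure.map_infinitePi_infinitePi_of_inj (P := fun q : Fin 5 × ℕ => m q.1) hf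

/-- The difference between the outputs of the channel and those of the channel restarted at
time `s` with the same noise. It is multiplied by `B` at each step. -/
def restartGap (x : ℕ → ℝ) (s j : ℕ) (ζ : Fin 5 × ℕ → ℝ) : ℝ :=
  chan x ζ (j + s) - chan (fun i => x (i + s)) (shiftNoise s ζ) j

theorem measurable_restartGap (x : ℕ → ℝ) (s j : ℕ) : Measurable (restartGap x s j) :=
  (measurable_chan x _).sub ((measurable_chan _ j).comp (measurable_shiftNoise s))

theorem restartGap_succ (x : ℕ → ℝ) (s j : ℕ) (ζ : Fin 5 × ℕ → ℝ) :
    restartGap x s (j + 1) ζ = ζ (1, j + 1 + s) * restartGap x s j ζ := by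
  rw [restartGap, restartGap, chan_add_succ, chan_succ, drift, drift]
  simp only [shiftNoise]
  ring

theorem lintegral_enorm_restartGap_le {x : ℕ → ℝ} {s : ℕ} {L : ℝ≥0}
    (hL : ∀ k, ∫⁻ ζ, ‖chan x ζ k‖ₑ ∂(noiseLaw m) ≤ L)
    (hL' : ∀ k, ∫⁻ ζ, ‖chan (fun i => x (i + s)) ζ k‖ₑ ∂(noiseLaw m) ≤ L) (j : ℕ) :
    ∫⁻ ζ, ‖restartGap x s j ζ‖ₑ ∂(noiseLaw m) ≤ (∫⁻ a, ‖a‖ₑ ∂(m 1)) ^ j * (2 * L) := by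
  induction j with
  | zero =>
    have h1 : ∫⁻ ζ, ‖chan (fun i => x (i + s)) (shiftNoise s ζ) 0‖ₑ ∂(noiseLaw m) ≤ L := by
      rw [← lintegral_map (f := fun ζ => ‖chan (fun i => x (i + s)) ζ 0‖ₑ) (by fun_prop)
        (measurable_shiftNoise s), map_shiftNoise]
      exact hL' 0
    have hm1 : Measurable fun ζ => chan (fun i => x (i + s)) (shiftNoise s ζ) 0 :=
      (measurable_chan _ 0).comp (measurable_shiftNoise s)
    calc _ ≤ ∫⁻ ζ, (‖chan x ζ (0 + s)‖ₑ + ‖chan (fun i => x (i + s)) (shiftNoise s ζ) 0‖ₑ)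
          ∂(noiseLaw m) := lintegral_mono fun ζ => enorm_sub_le
      _ ≤ L + L := by
          rw [lintegral_add_left (by fun_prop)]
          exact add_le_add (hL _) h1
      _ = _ := by rw [pow_zero, one_mul, two_mul]
  | succ j ih =>
    simp_rw [restartGap_succ, enorm_mul]
    have hmg := measurable_restartGap x s j
    have := lintegral_mul_coord (fun q : Fin 5 × ℕ => m q.1) (i := (1, j + 1 + s))
      (F := fun a => ‖a‖ₑ) (G := fun ζ => ‖restartGap x s j ζ‖ₑ) (by fun_prop) (by fun_prop) ?_
    · rw [noiseLaw, this, pow_succ', mul_assoc]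
      exact mul_le_mul_right ih _
    · intro ζ ζ' h
      have h1 : chan x ζ (j + s) = chan x ζ' (j + s) :=
        chan_congr (fun _ _ => rfl) (fun i hi => h _ (by simp))
          (fun j hj i hi => h _ (by simp; omega))
      have h2 : chan (fun i => x (i + s)) (shiftNoise s ζ) j =
          chan (fun i => x (i + s)) (shiftNoise s ζ') j :=
        chan_congr (fun _ _ => rfl) (fun i hi => h _ (by simp))
          (fun j hj i hi => h _ (by simp; omega))
      rw [restartGap, restartGap, h1, h2]

/-- Changing `W` at time `k` translates the output at time `k`. -/
theorem chan_sub_congr (x : ℕ → ℝ) {ζ ζ' : Fin 5 × ℕ → ℝ} {k : ℕ}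
    (h : ∀ q, q ≠ (3, k) → ζ q = ζ' q) :
    chan x ζ k - ζ (3, k) = chan x ζ' k - ζ' (3, k) := by
  cases k with
  | zero => rw [chan_zero, chan_zero, h (4, 0) (by simp)]; ring
  | succ k =>
    rw [chan_succ, chan_succ, chan_congr (ζ' := ζ') (fun _ _ => rfl) (fun i hi => h _ (by simp))
      (fun j hj i hi => h _ (by simp; omega)), drift, drift, h (0, _) (by simp), h (1, _) (by simp),
      h (2, _) (by simp), h (4, _) (by simp)]
    ring

/-- The noise `W` at time `N + s` may be integrated out first, against its Gaussian law. -/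
theorem integral_smoothing (hm : m 3 = gaussianReal 0 1) (s N : ℕ)
    {G : ℝ × (Fin 5 × ℕ → ℝ) → ℝ} (hG : Measurable G) {M : ℝ} (hM : ∀ z, |G z| ≤ M)
    (hGN : ∀ a ζ ζ', (∀ q, q ≠ (3, N) → ζ q = ζ' q) → G (a, ζ) = G (a, ζ'))
    {c : (Fin 5 × ℕ → ℝ) → ℝ} (hc : Measurable c)
    (hcN : ∀ ζ ζ', (∀ q, q ≠ (3, N + s) → ζ q = ζ' q) → c ζ = c ζ') :
    ∫ ζ, G (c ζ + ζ (3, N + s), shiftNoise s ζ) ∂(noiseLaw m) =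
      ∫ ζ, ∫ w, G (c ζ + w, shiftNoise s ζ) ∂(gaussianReal 0 1) ∂(noiseLaw m) := by
  classical
  have hsh := measurable_shiftNoise s
  have hF : Measurable fun ζ => G (c ζ + ζ (3, N + s), shiftNoise s ζ) := by fun_prop
  rw [noiseLaw, integral_resample _ {(3, N + s)} hF
    (Integrable.of_bound hF.aestronglyMeasurable M (ae_of_all _ fun ζ => hM _))]
  refine integral_congr_ae (ae_of_all _ fun ζ₂ => ?_)
  have : ∀ ζ₁ : Fin 5 × ℕ → ℝ,
      G (c (({(3, N + s)} : Set (Fin 5 × ℕ)).piecewise ζ₁ ζ₂) +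
        ({(3, N + s)} : Set (Fin 5 × ℕ)).piecewise ζ₁ ζ₂ (3, N + s),
        shiftNoise s (({(3, N + s)} : Set (Fin 5 × ℕ)).piecewise ζ₁ ζ₂)) =
      G (c ζ₂ + ζ₁ (3, N + s), shiftNoise s ζ₂) := by
    intro ζ₁
    rw [hcN _ ζ₂ fun j hj => by simp [Set.piecewise, hj], hGN _ _ (shiftNoise s ζ₂)]
    · simp [Set.piecewise]
    · rintro ⟨j, i⟩ hq
      have : (j, i + s) ≠ ((3, N + s) : Fin 5 × ℕ) := by
        intro h
        simp only [Prod.mk.injEq, add_left_inj] at h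
        exact hq (Prod.ext h.1 h.2)
      simp [shiftNoise, Set.piecewise, this]
  simp only [this]
  have h2 := integral_map (μ := Measure.infinitePi fun q : Fin 5 × ℕ => m q.1)
    (measurable_pi_apply (3, N + s)).aemeasurable
    (f := fun w => G (c ζ₂ + w, shiftNoise s ζ₂)) (by fun_prop : Measurable _).aestronglyMeasurable
  rw [Measure.infinitePi_map_eval, hm] at h2
  exact h2.symm

/-- The channel forgets its past: the expectation of a function of the outputs after time `N + s`
bounded by `M` changes by at most a multiple of `M * E|B| ^ N` when the channel is restarted at
time `s`. The gap between the outputs at time `N + s` is of order `E|B| ^ N`, and the Gaussian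
noise `W` at that time turns a small gap into a small distance in total variation. -/
theorem enorm_integral_chan_sub_restart_le (hm : m 3 = gaussianReal 0 1) {x : ℕ → ℝ} {s : ℕ}
    {L : ℝ≥0} (hL : ∀ k, ∫⁻ ζ, ‖chan x ζ k‖ₑ ∂(noiseLaw m) ≤ L)
    (hL' : ∀ k, ∫⁻ ζ, ‖chan (fun i => x (i + s)) ζ k‖ₑ ∂(noiseLaw m) ≤ L)
    {n N : ℕ} {h : (Fin (n + 1) → ℝ) → ℝ} (hh : Measurable h) {M : ℝ} (hM : ∀ y, |h y| ≤ M)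
    (hN : ∀ y y' : Fin (n + 1) → ℝ, (∀ i : Fin (n + 1), N ≤ i → y i = y' i) → h y = h y') :
    ‖∫ ζ, h (fun i => chan x ζ (i + s)) ∂(noiseLaw m) -
        ∫ ζ, h (fun i => chan (fun i => x (i + s)) ζ i) ∂(noiseLaw m)‖ₑ ≤
      ENNReal.ofReal M * (∫⁻ w, ‖w‖ₑ ∂(gaussianReal 0 1)) *
        ((∫⁻ a, ‖a‖ₑ ∂(m 1)) ^ N * (2 * L)) := by
  set x' : ℕ → ℝ := fun i => x (i + s) with hx'
  have hsh := measurable_shiftNoise s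
  let G : ℝ × (Fin 5 × ℕ → ℝ) → ℝ := fun z =>
    h fun i => if (i : ℕ) < N then 0 else chanFrom x' z.2 N z.1 (i - N)
  have hGm : Measurable G := by
    refine hh.comp (measurable_pi_lambda _ fun i => ?_)
    by_cases hi : (i : ℕ) < N
    · simp only [hi, if_true]; fun_prop
    · simp only [hi, if_false]; exact measurable_chanFrom x' N _
  have hGM : ∀ z, |G z| ≤ M := fun z => hM _
  have hGN : ∀ a ζ ζ', (∀ q, q ≠ (3, N) → ζ q = ζ' q) → G (a, ζ) = G (a, ζ') := by
    intro a ζ ζ' hq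
    simp only [G]
    congr 1
    funext i
    rw [chanFrom_congr x' hq]
  -- a sequence driven by the recursion of the channel enters `h` through `G` only
  have key : ∀ (y : ℕ → ℝ) (ζ : Fin 5 × ℕ → ℝ),
      (∀ k, y (k + 1) = drift x' k (y k) ζ + ζ (3, k + 1)) →
      h (fun i => y i) = G (y N, ζ) := by
    intro y ζ hy
    refine hN _ _ fun i hi => ?_
    rw [if_neg (by omega), ← eq_chanFrom hy, Nat.add_sub_cancel' hi]
  have e1 : ∫ ζ, h (fun i => chan x ζ (i + s)) ∂(noiseLaw m) =
      ∫ ζ, ∫ w, G (chan x ζ (N + s) - ζ (3, N + s) + w, shiftNoise s ζ)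
        ∂(gaussianReal 0 1) ∂(noiseLaw m) := by
    rw [← integral_smoothing m hm s N hGm hGM hGN
      (c := fun ζ => chan x ζ (N + s) - ζ (3, N + s)) (by fun_prop)
      (fun ζ ζ' hq => chan_sub_congr x hq)]
    refine integral_congr_ae (ae_of_all _ fun ζ => ?_)
    simp only [sub_add_cancel]
    exact key (fun j => chan x ζ (j + s)) (shiftNoise s ζ) (chan_add_succ x ζ s)
  have e2 : ∫ ζ, h (fun i => chan x' ζ i) ∂(noiseLaw m) =
      ∫ ζ, ∫ w, G (chan x' (shiftNoise s ζ) N - ζ (3, N + s) + w, shiftNoise s ζ)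
        ∂(gaussianReal 0 1) ∂(noiseLaw m) := by
    have hc : Measurable fun ζ => chan x' (shiftNoise s ζ) N - ζ (3, N + s) :=
      ((measurable_chan x' N).comp hsh).sub (measurable_pi_apply _)
    rw [← integral_smoothing m hm s N hGm hGM hGN
      (c := fun ζ => chan x' (shiftNoise s ζ) N - ζ (3, N + s)) hc ?_]
    · conv_lhs => rw [← map_shiftNoise m s]
      rw [integral_map hsh.aemeasurable (f := fun ζ => h fun i => chan x' ζ i)
        (hh.comp (measurable_chan_block x' n)).aestronglyMeasurable]
      refine integral_congr_ae (ae_of_all _ fun ζ => ?_)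
      simp only [sub_add_cancel]
      exact key (chan x' (shiftNoise s ζ)) (shiftNoise s ζ) (chan_succ x' _)
    · intro ζ ζ' hq
      refine chan_sub_congr (k := N) x' (ζ := shiftNoise s ζ) (ζ' := shiftNoise s ζ') ?_
      rintro ⟨j, i⟩ hji
      refine hq _ fun h => hji ?_
      simp only [Prod.mk.injEq, add_left_inj] at h
      exact Prod.ext h.1 h.2
  have hint : ∀ c : (Fin 5 × ℕ → ℝ) → ℝ, Measurable c →
      Integrable (fun ζ => ∫ w, G (c ζ + w, shiftNoise s ζ) ∂(gaussianReal 0 1))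
        (noiseLaw m) := by
    intro c hc
    refine Integrable.of_bound (C := M) ?_ (ae_of_all _ fun ζ => ?_)
    · refine StronglyMeasurable.aestronglyMeasurable (StronglyMeasurable.integral_prod_right
        (f := fun ζ w => G (c ζ + w, shiftNoise s ζ)) (Measurable.stronglyMeasurable ?_))
      simp only [Function.uncurry_def]
      fun_prop
    · refine (norm_integral_le_of_norm_le_const (ae_of_all _ fun w => hGM _)).trans ?_
      simp
  rw [e1, e2, ← integral_sub (hint _ (by fun_prop)) (hint _ ?_)]
  · calc _ ≤ ∫⁻ ζ, ENNReal.ofReal M * (∫⁻ w, ‖w‖ₑ ∂(gaussianReal 0 1)) *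
          ‖restartGap x s N ζ‖ₑ ∂(noiseLaw m) := by
          refine (enorm_integral_le_lintegral_enorm _).trans (lintegral_mono fun ζ => ?_)
          refine (enorm_integral_gaussianReal_add_sub_le
            (H := fun a => G (a, shiftNoise s ζ)) (by fun_prop) (fun a => hGM _) _ _).trans_eq ?_
          rw [sub_sub_sub_cancel_right]
          rfl
      _ ≤ _ := by
          rw [lintegral_const_mul _ (measurable_restartGap x s N).enorm]
          exact mul_le_mul_right (lintegral_enorm_restartGap_le m hL hL' N) _
  · exact ((measurable_chan x' N).comp hsh).sub (measurable_pi_apply _)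

end Forgetting

/-! ### Decoders that ignore the first outputs -/

section TruncatedDecoder

/-- The Laplace density. -/
noncomputable def laplaceDensity (a : ℝ) : ℝ := Real.exp (-|a|) / 2

theorem laplaceDensity_pos (a : ℝ) : 0 < laplaceDensity a := by unfold laplaceDensity; positivity

theorem measurable_laplaceDensity : Measurable laplaceDensity := by
  unfold laplaceDensity; fun_prop

theorem log_laplaceDensity (a : ℝ) : Real.log (laplaceDensity a) = -(Real.log 2 + |a|) := by
  rw [laplaceDensity, Real.log_div (Real.exp_ne_zero _) two_ne_zero, Real.log_exp]
  ring

theorem lintegral_laplaceDensity : ∫⁻ a, ENNReal.ofReal (laplaceDensity a) = 1 := by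
  have h : ∫ a, laplaceDensity a = 1 := by
    unfold laplaceDensity
    rw [integral_div, integral_comp_abs (f := fun a => Real.exp (-a)), integral_exp_neg_Ioi_zero]
    norm_num
  have hi : Integrable laplaceDensity := by
    by_contra hcon
    rw [integral_undef hcon] at h
    exact zero_ne_one h
  rw [← ofReal_integral_eq_lintegral_ofReal hi (ae_of_all _ fun a => (laplaceDensity_pos a).le), h,
    ENNReal.ofReal_one]

variable (m : Fin 5 → Measure ℝ) [∀ j, IsProbabilityMeasure (m j)]

/-- The output density in which the conditional densities of the outputs up to time `N` have been
replaced by the Laplace density. -/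
noncomputable def truncDensity (N : ℕ) (x : ℕ → ℝ) (n : ℕ) : (Fin (n + 1) → ℝ) → ℝ :=
  markovDensity laplaceDensity
    (fun k s a => if k < N then laplaceDensity a else transDensity m x k s a) n

theorem measurable_truncTrans (N : ℕ) (x : ℕ → ℝ) (k : ℕ) :
    Measurable fun z : ℝ × ℝ =>
      if k < N then laplaceDensity z.2 else transDensity m x k z.1 z.2 := by
  by_cases h : k < N
  · simp only [h, if_true]; exact measurable_laplaceDensity.comp measurable_snd
  · simp only [h, if_false]; exact measurable_transDensity m x k

theorem truncTrans_pos (N : ℕ) (x : ℕ → ℝ) (k : ℕ) (s a : ℝ) :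
    0 < if k < N then laplaceDensity a else transDensity m x k s a := by
  split_ifs
  · exact laplaceDensity_pos a
  · exact transDensity_pos m x k s a

theorem measurable_truncDensity (N : ℕ) (x : ℕ → ℝ) (n : ℕ) : Measurable (truncDensity m N x n) :=
  measurable_markovDensity measurable_laplaceDensity (measurable_truncTrans m N x) n

theorem truncDensity_pos (N : ℕ) (x : ℕ → ℝ) (n : ℕ) (y : Fin (n + 1) → ℝ) :
    0 < truncDensity m N x n y :=
  markovDensity_pos laplaceDensity_pos (truncTrans_pos m N x) n y

theorem lintegral_truncDensity (N : ℕ) (x : ℕ → ℝ) (n : ℕ) :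
    ∫⁻ y, ENNReal.ofReal (truncDensity m N x n y) = 1 := by
  refine lintegral_markovDensity measurable_laplaceDensity (measurable_truncTrans m N x)
    laplaceDensity_pos (truncTrans_pos m N x) lintegral_laplaceDensity (fun k s => ?_) n
  by_cases h : k < N
  · simp only [h, if_true]; exact lintegral_laplaceDensity
  · simp only [h, if_false]; exact lintegral_smoothedDensity _ (measurable_drift_right x k s)

/-- An upper bound for the logarithm of the ratio of the output density to its truncation at
time `N`. -/
noncomputable def truncCost (N n : ℕ) (y : Fin (n + 1) → ℝ) : ℝ :=
  Real.log 2 + |y 0| + ∑ k : Fin n, if (k : ℕ) < N then Real.log 2 + |y k.succ| else 0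

theorem measurable_truncCost (N n : ℕ) : Measurable (truncCost N n) := by
  unfold truncCost
  refine Measurable.add (by fun_prop) (Finset.measurable_sum _ fun k _ => ?_)
  split_ifs <;> fun_prop

theorem log_chanDensity_div_truncDensity_le (N : ℕ) (x : ℕ → ℝ) (n : ℕ) (y : Fin (n + 1) → ℝ) :
    Real.log (chanDensity m x n y / truncDensity m N x n y) ≤ truncCost N n y := by
  rw [Real.log_div (chanDensity_pos m x n y).ne' (truncDensity_pos m N x n y).ne', chanDensity,
    truncDensity, markovDensity, markovDensity,
    Real.log_mul (initDensity_pos m x _).ne'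
      (Finset.prod_pos fun k _ => transDensity_pos m x _ _ _).ne',
    Real.log_mul (laplaceDensity_pos _).ne'
      (Finset.prod_pos fun k _ => truncTrans_pos m N x _ _ _).ne',
    Real.log_prod fun k _ => (transDensity_pos m x _ _ _).ne',
    Real.log_prod fun k _ => (truncTrans_pos m N x _ _ _).ne', add_sub_add_comm,
    ← Finset.sum_sub_distrib, truncCost, log_laplaceDensity]
  refine add_le_add ?_ (Finset.sum_le_sum fun k _ => ?_)
  · have := Real.log_nonpos (initDensity_pos m x (y 0)).le
      (smoothedDensity_le_one _ (by fun_prop) _)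
    linarith
  · split_ifs
    · have := Real.log_nonpos (transDensity_pos m x k (y k.castSucc) (y k.succ)).le
        (smoothedDensity_le_one _ (measurable_drift_right x _ _) _)
      rw [log_laplaceDensity]
      linarith
    · rw [sub_self]

/-- The outputs before time `N` enter the truncated density through a factor that does not depend
on the input, so that they cancel in the Bayes decoder. -/
theorem truncDensity_factor (N : ℕ) (n : ℕ) {y y' : Fin (n + 1) → ℝ}
    (h : ∀ i : Fin (n + 1), N ≤ i → y i = y' i) :
    ∃ C : ℝ, C ≠ 0 ∧ ∀ x, truncDensity m N x n y' = C * truncDensity m N x n y := by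
  let R : (Fin (n + 1) → ℝ) → ℝ := fun y =>
    laplaceDensity (y 0) * ∏ k : Fin n, if (k : ℕ) < N then laplaceDensity (y k.succ) else 1
  have hR : ∀ y, 0 < R y := fun y => mul_pos (laplaceDensity_pos _)
    (Finset.prod_pos fun k _ => by split_ifs; exacts [laplaceDensity_pos _, one_pos])
  have hfac : ∀ x y, truncDensity m N x n y = R y *
      ∏ k : Fin n, if (k : ℕ) < N then 1 else transDensity m x k (y k.castSucc) (y k.succ) := by
    intro x y
    rw [truncDensity, markovDensity, mul_assoc, ← Finset.prod_mul_distrib]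
    congr 1
    refine Finset.prod_congr rfl fun k _ => ?_
    split_ifs <;> simp
  refine ⟨R y' / R y, (div_pos (hR _) (hR _)).ne', fun x => ?_⟩
  rw [hfac, hfac, ← mul_assoc, div_mul_cancel₀ _ (hR y).ne']
  congr 1
  refine Finset.prod_congr rfl fun k _ => ?_
  split_ifs with hk
  · rfl
  · rw [h k.castSucc (by simp; omega), h k.succ (by simp; omega)]

theorem integrable_chan {x : ℕ → ℝ} {k : ℕ} {L : ℝ≥0}
    (hL : ∫⁻ ζ, ‖chan x ζ k‖ₑ ∂(noiseLaw m) ≤ L) :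
    Integrable (fun ζ => chan x ζ k) (noiseLaw m) :=
  ⟨(measurable_chan x k).aestronglyMeasurable, hL.trans_lt ENNReal.coe_lt_top⟩

theorem integral_abs_chan_le {x : ℕ → ℝ} {k : ℕ} {L : ℝ≥0}
    (hL : ∫⁻ ζ, ‖chan x ζ k‖ₑ ∂(noiseLaw m) ≤ L) :
    ∫ ζ, |chan x ζ k| ∂(noiseLaw m) ≤ L := by
  simp_rw [← Real.norm_eq_abs]
  rw [integral_norm_eq_lintegral_enorm (measurable_chan x k).aestronglyMeasurable]
  exact ENNReal.toReal_le_of_le_ofReal L.2 (by simpa using hL)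

/-- The law of the output block of length `n + 1` for the input `x`. -/
noncomputable def blockLaw (x : ℕ → ℝ) (n : ℕ) : Measure (Fin (n + 1) → ℝ) :=
  (noiseLaw m).map fun ζ i => chan x ζ i

theorem integrable_truncCost {x : ℕ → ℝ} {L : ℝ≥0}
    (hL : ∀ k, ∫⁻ ζ, ‖chan x ζ k‖ₑ ∂(noiseLaw m) ≤ L) (N n : ℕ) :
    Integrable (truncCost N n) (blockLaw m x n) ∧
      ∫ y, truncCost N n y ∂(blockLaw m x n) ≤ (N + 1) * (Real.log 2 + L) := by
  have hm := measurable_chan_block x n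
  have hi : ∀ k, Integrable (fun ζ => Real.log 2 + |chan x ζ k|) (noiseLaw m) := fun k =>
    (integrable_const _).add (integrable_chan m (hL k)).abs
  have hb : ∀ k, ∫ ζ, (Real.log 2 + |chan x ζ k|) ∂(noiseLaw m) ≤ Real.log 2 + L := fun k => by
    rw [integral_add (integrable_const _) (integrable_chan m (hL k)).abs]
    simpa using integral_abs_chan_le m (hL k)
  have hi' : ∀ k : Fin n, Integrable (fun ζ => if (k : ℕ) < N then
      Real.log 2 + |chan x ζ ((k : ℕ) + 1)| else 0) (noiseLaw m) := fun k => by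
    by_cases hk : (k : ℕ) < N
    · simp only [hk, if_true]; exact hi _
    · simp only [hk, if_false]; exact integrable_zero _ _ _
  have heq : ∀ ζ, truncCost N n (fun i => chan x ζ i) = Real.log 2 + |chan x ζ 0| +
      ∑ k : Fin n, if (k : ℕ) < N then Real.log 2 + |chan x ζ ((k : ℕ) + 1)| else 0 :=
    fun ζ => rfl
  constructor
  · rw [blockLaw, integrable_map_measure (measurable_truncCost N n).aestronglyMeasurable
      hm.aemeasurable]
    exact (hi 0).add (integrable_finsetSum _ fun k _ => hi' k)
  · rw [blockLaw, integral_map hm.aemeasurable (measurable_truncCost N n).aestronglyMeasurable]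
    simp_rw [heq]
    rw [integral_add (hi 0) (integrable_finsetSum _ fun k _ => hi' k),
      integral_finsetSum _ fun k _ => hi' k]
    have hT : (0 : ℝ) ≤ Real.log 2 + L := by positivity
    have hsum : ∑ k : Fin n, ∫ ζ, (if (k : ℕ) < N then Real.log 2 + |chan x ζ ((k : ℕ) + 1)|
        else 0) ∂(noiseLaw m) ≤ N * (Real.log 2 + L) := by
      calc _ ≤ ∑ k : Fin n, if (k : ℕ) < N then Real.log 2 + L else 0 := by
            refine Finset.sum_le_sum fun k _ => ?_
            by_cases hk : (k : ℕ) < N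
            · simp only [hk, if_true]; exact hb _
            · simp [hk]
        _ = ∑ k ∈ Finset.range n, if k < N then Real.log 2 + L else 0 :=
            Fin.sum_univ_eq_sum_range (fun k => if k < N then Real.log 2 + (L : ℝ) else 0) n
        _ = ((Finset.range n).filter (· < N)).card * (Real.log 2 + L) := by
            rw [← Finset.sum_filter, Finset.sum_const, nsmul_eq_mul]
        _ ≤ N * (Real.log 2 + L) := by
            refine mul_le_mul_of_nonneg_right ?_ hT
            have : (Finset.range n).filter (· < N) ⊆ Finset.range N := fun k hk => by
              simp only [Finset.mem_filter] at hk
              exact Finset.mem_range.2 hk.2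
            have := Finset.card_le_card this
            rw [Finset.card_range] at this
            exact_mod_cast this
    linarith [hb 0]

end TruncatedDecoder

section BlockInformation

variable (m : Fin 5 → Measure ℝ) [∀ j, IsProbabilityMeasure (m j)] {𝒳 : Finset ℝ}

/-- The output law of the block channel for the input block `x`. -/
noncomputable def codeLaw (n : ℕ) (x : Fin (n + 1) → 𝒳) : Measure (Fin (n + 1) → ℝ) :=
  blockLaw m (extendBlock x) n

/-- The output density of the block channel for the input block `x`. -/
noncomputable def codeDensity (n : ℕ) (x : Fin (n + 1) → 𝒳) : (Fin (n + 1) → ℝ) → ℝ :=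
  chanDensity m (extendBlock x) n

theorem isDensityChannel_codeLaw (hm : m 3 = gaussianReal 0 1) (n : ℕ) :
    IsDensityChannel volume (codeDensity m n) (codeLaw m (𝒳 := 𝒳) n) where
  measurable _ := measurable_chanDensity m _ n
  pos _ y := chanDensity_pos m _ n y
  prob _ := Measure.isProbabilityMeasure_map (measurable_chan_block _ n).aemeasurable
  eq _ := map_chan_block m hm _ n

/-- The mutual information between an input block with law `p` and the output block. -/
noncomputable def information (n : ℕ) (p : Measure (Fin (n + 1) → 𝒳)) : ℝ :=
  ∫ z, Real.log (codeDensity m n z.1 z.2 / mixtureDensity p (codeDensity m n) z.2)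
    ∂(jointLaw p (codeLaw m n))

/-- The Bayes decoder depends on the densities only up to a factor common to all inputs. -/
theorem bayesDecoder_congr {α β : Type*} [Fintype α] [MeasurableSpace α] [MeasurableSpace β]
    (p : Measure α) {g : α → β → ℝ} {y y' : β} {C : ℝ} (hC : C ≠ 0)
    (h : ∀ x, g x y' = C * g x y) (x : α) : bayesDecoder p g x y = bayesDecoder p g x y' := by
  have hmix : mixtureDensity p g y' = C * mixtureDensity p g y := by
    simp only [mixtureDensity, h, Finset.mul_sum]
    exact Finset.sum_congr rfl fun x _ => by ring
  rw [bayesDecoder, bayesDecoder, hmix, h, mul_left_comm, mul_div_mul_left _ _ hC]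

/-- Ignoring the first `N` outputs of a block costs an amount of information that does not depend
on the length of the block. -/
theorem exists_decoder (hm : m 3 = gaussianReal 0 1) (h𝒳 : 𝒳.Nonempty) {L : ℝ≥0}
    (N n : ℕ)
    (hL : ∀ (x : Fin (n + 1) → 𝒳) k, ∫⁻ ζ, ‖chan (extendBlock x) ζ k‖ₑ ∂(noiseLaw m) ≤ L)
    (p : Measure (Fin (n + 1) → 𝒳)) [IsProbabilityMeasure p] :
    ∃ q : (Fin (n + 1) → 𝒳) → (Fin (n + 1) → ℝ) → ℝ,
      IsDecoder (((𝒳.card : ℝ) ^ (n + 1))⁻¹ / 2) q ∧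
      (∀ x y y', (∀ i : Fin (n + 1), N ≤ i → y i = y' i) → q x y = q x y') ∧
      information m n p ≤ entropy p + decoderScore p (codeLaw m n) q + Real.log 2 +
        (N + 1) * (Real.log 2 + L) := by
  have : Nonempty 𝒳 := h𝒳.to_subtype
  let g : (Fin (n + 1) → 𝒳) → (Fin (n + 1) → ℝ) → ℝ := fun x => truncDensity m N (extendBlock x) n
  have hg : ∀ x, Measurable (g x) := fun x => measurable_truncDensity m N _ n
  have hg0 : ∀ x y, 0 < g x y := fun x y => truncDensity_pos m N _ n y
  refine ⟨bayesDecoder p g, ?_, fun x y y' h => ?_, ?_⟩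
  · have := isDecoder_bayesDecoder p hg hg0
    simpa using this
  · obtain ⟨C, hC, hCx⟩ := truncDensity_factor m N n h
    exact bayesDecoder_congr p hC (fun x => hCx (extendBlock x)) x
  · exact (isDensityChannel_codeLaw m hm n).le_entropy_add_decoderScore p hg hg0
      (fun x => lintegral_truncDensity m N _ n) (measurable_truncCost N n)
      (fun x y => log_chanDensity_div_truncDensity_le m N _ n y)
      (fun x => (integrable_truncCost m (hL x) N n).1)
      (fun x => (integrable_truncCost m (hL x) N n).2)

end BlockInformation

/-! ### Superadditivity of the information -/

section Concatenation

/-- Concatenation of a block of length `a + 1` and a block of length `b + 1`. -/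
def joinBlocks (T : Type*) (a b : ℕ) :
    (Fin (a + 1) → T) × (Fin (b + 1) → T) ≃ (Fin (a + 1 + b + 1) → T) where
  toFun z := Fin.append (m := a + 1) (n := b + 1) z.1 z.2
  invFun x := (fun i => x (Fin.castAdd (b + 1) i), fun i => x (Fin.natAdd (a + 1) i))
  left_inv z := by ext i <;> simp
  right_inv x := Fin.append_castAdd_natAdd (m := a + 1) (n := b + 1)

theorem extendBlock_joinBlocks_left {𝒳 : Finset ℝ} {a b : ℕ} (x₁ : Fin (a + 1) → 𝒳)
    (x₂ : Fin (b + 1) → 𝒳) {i : ℕ} (hi : i ≤ a) :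
    extendBlock (joinBlocks 𝒳 a b (x₁, x₂)) i = extendBlock x₁ i := by
  rw [extendBlock, extendBlock, dif_pos (show i < a + 1 + b + 1 by omega),
    dif_pos (show i < a + 1 by omega)]
  have := Fin.append_left x₁ x₂ ⟨i, by omega⟩
  exact congrArg Subtype.val this

theorem extendBlock_joinBlocks_right {𝒳 : Finset ℝ} {a b : ℕ} (x₁ : Fin (a + 1) → 𝒳)
    (x₂ : Fin (b + 1) → 𝒳) (i : ℕ) :
    extendBlock (joinBlocks 𝒳 a b (x₁, x₂)) (i + (a + 1)) = extendBlock x₂ i := by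
  by_cases hi : i < b + 1
  · rw [extendBlock, extendBlock, dif_pos (show i + (a + 1) < a + 1 + b + 1 by omega), dif_pos hi]
    have h := Fin.append_right x₁ x₂ ⟨i, hi⟩
    have hidx : (⟨i + (a + 1), by omega⟩ : Fin (a + 1 + (b + 1))) = Fin.natAdd (a + 1) ⟨i, hi⟩ :=
      Fin.ext (Nat.add_comm _ _)
    rw [← hidx] at h
    exact congrArg Subtype.val h
  · rw [extendBlock, extendBlock, dif_neg (show ¬ i + (a + 1) < a + 1 + b + 1 by omega),
      dif_neg hi]

variable (m : Fin 5 → Measure ℝ) [∀ j, IsProbabilityMeasure (m j)] {𝒳 : Finset ℝ}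

/-- The law of the concatenation of two independent blocks. -/
noncomputable def joinLaw {a b : ℕ} (p₁ : Measure (Fin (a + 1) → 𝒳))
    (p₂ : Measure (Fin (b + 1) → 𝒳)) : Measure (Fin (a + 1 + b + 1) → 𝒳) :=
  (p₁.prod p₂).map (joinBlocks 𝒳 a b)

variable {a b : ℕ} (p₁ : Measure (Fin (a + 1) → 𝒳)) [IsProbabilityMeasure p₁]
  (p₂ : Measure (Fin (b + 1) → 𝒳)) [IsProbabilityMeasure p₂]

instance : IsProbabilityMeasure (joinLaw p₁ p₂) :=
  Measure.isProbabilityMeasure_map (measurable_of_countable _).aemeasurable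

theorem joinLaw_real_singleton (z : (Fin (a + 1) → 𝒳) × (Fin (b + 1) → 𝒳)) :
    (joinLaw p₁ p₂).real {joinBlocks 𝒳 a b z} = p₁.real {z.1} * p₂.real {z.2} := by
  rw [joinLaw, map_measureReal_apply (measurable_of_countable _) (MeasurableSet.singleton _),
    ← Set.image_singleton, (joinBlocks 𝒳 a b).injective.preimage_image,
    ← measureReal_prod_prod, Set.singleton_prod_singleton]

theorem entropy_joinLaw : entropy (joinLaw p₁ p₂) = entropy p₁ + entropy p₂ := by
  rw [entropy, ← (joinBlocks 𝒳 a b).sum_comp, Fintype.sum_prod_type]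
  simp_rw [joinLaw_real_singleton, Real.negMulLog_mul, Finset.sum_add_distrib, ← Finset.sum_mul,
    ← Finset.mul_sum]
  rw [sum_measureReal_singleton_eq_one, ← Finset.sum_mul, sum_measureReal_singleton_eq_one,
    one_mul, one_mul]
  rfl

/-- The decoder that applies `q₁` to the first part of the block and `q₂` to the second part. -/
def joinDecoder (q₁ : (Fin (a + 1) → 𝒳) → (Fin (a + 1) → ℝ) → ℝ)
    (q₂ : (Fin (b + 1) → 𝒳) → (Fin (b + 1) → ℝ) → ℝ) (x : Fin (a + 1 + b + 1) → 𝒳)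
    (y : Fin (a + 1 + b + 1) → ℝ) : ℝ :=
  q₁ ((joinBlocks 𝒳 a b).symm x).1 ((joinBlocks ℝ a b).symm y).1 *
    q₂ ((joinBlocks 𝒳 a b).symm x).2 ((joinBlocks ℝ a b).symm y).2

theorem measurable_joinBlocks_symm : Measurable (joinBlocks ℝ a b).symm :=
  (measurable_pi_lambda _ fun _ => measurable_pi_apply _).prodMk
    (measurable_pi_lambda _ fun _ => measurable_pi_apply _)

theorem isDecoder_joinDecoder {q₁ : (Fin (a + 1) → 𝒳) → (Fin (a + 1) → ℝ) → ℝ}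
    {q₂ : (Fin (b + 1) → 𝒳) → (Fin (b + 1) → ℝ) → ℝ} {δ₁ δ₂ : ℝ} (h₁ : IsDecoder δ₁ q₁)
    (h₂ : IsDecoder δ₂ q₂) : IsDecoder (δ₁ * δ₂) (joinDecoder q₁ q₂) where
  measurable x := ((h₁.measurable _).comp (measurable_fst.comp measurable_joinBlocks_symm)).mul
    ((h₂.measurable _).comp (measurable_snd.comp measurable_joinBlocks_symm))
  pos := mul_pos h₁.pos h₂.pos
  le x y := mul_le_mul (h₁.le _ _) (h₂.le _ _) h₂.pos.le (h₁.apply_pos _ _).le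
  sum_le_one y := by
    rw [← (joinBlocks 𝒳 a b).sum_comp, Fintype.sum_prod_type]
    simp only [joinDecoder, Equiv.symm_apply_apply]
    rw [← Finset.sum_mul_sum]
    exact mul_le_one₀ (h₁.sum_le_one _) (Finset.sum_nonneg fun x _ => (h₂.apply_pos _ _).le)
      (h₂.sum_le_one _)

/-- The joint decoder keeps the score of the first block, by causality, and loses at most `η` on
the second block if the score of `q₂` suffers at most that much from the initial state left by the
first block. -/
theorem decoderScore_joinDecoder_ge {q₁ : (Fin (a + 1) → 𝒳) → (Fin (a + 1) → ℝ) → ℝ}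
    {q₂ : (Fin (b + 1) → 𝒳) → (Fin (b + 1) → ℝ) → ℝ} {δ₁ δ₂ : ℝ} (h₁ : IsDecoder δ₁ q₁)
    (h₂ : IsDecoder δ₂ q₂) {η : ℝ}
    (hη : ∀ x₁ x₂, ∫ ζ, Real.log (q₂ x₂ fun i => chan (extendBlock x₂) ζ i) ∂(noiseLaw m) - η ≤
      ∫ ζ, Real.log (q₂ x₂ fun i => chan (extendBlock (joinBlocks 𝒳 a b (x₁, x₂))) ζ (i + (a + 1)))
        ∂(noiseLaw m)) :
    decoderScore p₁ (codeLaw m a) q₁ + decoderScore p₂ (codeLaw m b) q₂ - η ≤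
      decoderScore (joinLaw p₁ p₂) (codeLaw m (a + 1 + b)) (joinDecoder q₁ q₂) := by
  have hq₁ := h₁.measurable
  have hq₂ := h₂.measurable
  have hterm : ∀ x₁ x₂, ∫ y, Real.log (q₁ x₁ y) ∂(codeLaw m a x₁) +
      (∫ y, Real.log (q₂ x₂ y) ∂(codeLaw m b x₂) - η) ≤
      ∫ y, Real.log (joinDecoder q₁ q₂ (joinBlocks 𝒳 a b (x₁, x₂)) y)
        ∂(codeLaw m (a + 1 + b) (joinBlocks 𝒳 a b (x₁, x₂))) := by
    intro x₁ x₂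
    set x := joinBlocks 𝒳 a b (x₁, x₂) with hx
    have hblk := measurable_chan_block (extendBlock x) (a + 1 + b)
    have hm1 : Measurable fun ζ (i : Fin (a + 1)) => chan (extendBlock x₁) ζ i :=
      measurable_chan_block (extendBlock x₁) a
    have hm2 : Measurable fun ζ (i : Fin (b + 1)) => chan (extendBlock x) ζ (i + (a + 1)) :=
      measurable_pi_lambda _ fun i => measurable_chan _ _
    have hb : ∀ (F : (Fin 5 × ℕ → ℝ) → ℝ) (C : ℝ), Measurable F → (∀ ζ, |F ζ| ≤ C) →
        Integrable F (noiseLaw m) := fun F C hF hC =>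
      Integrable.of_bound hF.aestronglyMeasurable C (ae_of_all _ hC)
    rw [codeLaw, blockLaw, integral_map (measurable_chan_block _ _).aemeasurable
      (by fun_prop : Measurable _).aestronglyMeasurable, codeLaw, blockLaw,
      integral_map (measurable_chan_block _ _).aemeasurable
      (by fun_prop : Measurable _).aestronglyMeasurable, codeLaw, blockLaw,
      integral_map hblk.aemeasurable
        ((isDecoder_joinDecoder h₁ h₂).measurable x).log.aestronglyMeasurable]
    have hsplit : ∀ ζ, Real.log (joinDecoder q₁ q₂ x fun i => chan (extendBlock x) ζ i) =
        Real.log (q₁ x₁ fun i => chan (extendBlock x₁) ζ i) +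
          Real.log (q₂ x₂ fun i => chan (extendBlock x) ζ (i + (a + 1))) := by
      intro ζ
      rw [joinDecoder, Real.log_mul (h₁.apply_pos _ _).ne' (h₂.apply_pos _ _).ne']
      have e1 : ((joinBlocks ℝ a b).symm fun i => chan (extendBlock x) ζ i).1 =
          fun i : Fin (a + 1) => chan (extendBlock x₁) ζ i := by
        funext i
        refine chan_congr (fun k hk => ?_) (fun _ _ => rfl) (fun _ _ _ _ => rfl)
        exact extendBlock_joinBlocks_left x₁ x₂ (hk.trans (by simp; omega))
      have e2 : ((joinBlocks ℝ a b).symm fun i => chan (extendBlock x) ζ i).2 =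
          fun i : Fin (b + 1) => chan (extendBlock x) ζ (i + (a + 1)) := by
        funext i
        exact congrArg (chan (extendBlock x) ζ) (Nat.add_comm _ _)
      rw [e1, e2, hx, Equiv.symm_apply_apply]
    simp_rw [hsplit]
    rw [integral_add
      (hb (fun ζ => Real.log (q₁ x₁ fun i => chan (extendBlock x₁) ζ i)) (-Real.log δ₁)
        (((hq₁ x₁).comp hm1).log) fun ζ => h₁.abs_log_le _ _)
      (hb (fun ζ => Real.log (q₂ x₂ fun i => chan (extendBlock x) ζ (i + (a + 1)))) (-Real.log δ₂)
        (((hq₂ x₂).comp hm2).log) fun ζ => h₂.abs_log_le _ _)]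
    exact add_le_add_right (hη x₁ x₂) _
  calc decoderScore p₁ (codeLaw m a) q₁ + decoderScore p₂ (codeLaw m b) q₂ - η
      = ∑ x₁, ∑ x₂, p₁.real {x₁} * p₂.real {x₂} * (∫ y, Real.log (q₁ x₁ y) ∂(codeLaw m a x₁) +
          (∫ y, Real.log (q₂ x₂ y) ∂(codeLaw m b x₂) - η)) := by
        have s1 := sum_measureReal_singleton_eq_one p₁
        have s2 := sum_measureReal_singleton_eq_one p₂
        have e : ∀ x₁, ∑ x₂, p₁.real {x₁} * p₂.real {x₂} *
            (∫ y, Real.log (q₁ x₁ y) ∂(codeLaw m a x₁) +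
              (∫ y, Real.log (q₂ x₂ y) ∂(codeLaw m b x₂) - η)) =
            p₁.real {x₁} * ∫ y, Real.log (q₁ x₁ y) ∂(codeLaw m a x₁) +
              p₁.real {x₁} * (decoderScore p₂ (codeLaw m b) q₂ - η) := by
          intro x₁
          have e' : ∀ x₂, p₁.real {x₁} * p₂.real {x₂} *
            (∫ y, Real.log (q₁ x₁ y) ∂(codeLaw m a x₁) +
              (∫ y, Real.log (q₂ x₂ y) ∂(codeLaw m b x₂) - η)) =
            p₂.real {x₂} * (p₁.real {x₁} * ∫ y, Real.log (q₁ x₁ y) ∂(codeLaw m a x₁)) +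
            (p₁.real {x₁} * (p₂.real {x₂} * ∫ y, Real.log (q₂ x₂ y) ∂(codeLaw m b x₂)) -
              p₂.real {x₂} * (p₁.real {x₁} * η)) := fun x₂ => by ring
          simp_rw [e']
          rw [Finset.sum_add_distrib, Finset.sum_sub_distrib, ← Finset.sum_mul, ← Finset.sum_mul,
            ← Finset.mul_sum, s2, decoderScore]
          ring
        simp_rw [e]
        rw [Finset.sum_add_distrib, ← Finset.sum_mul, s1, one_mul, decoderScore]
        ring
    _ ≤ ∑ x₁, ∑ x₂, p₁.real {x₁} * p₂.real {x₂} *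
          ∫ y, Real.log (joinDecoder q₁ q₂ (joinBlocks 𝒳 a b (x₁, x₂)) y)
            ∂(codeLaw m (a + 1 + b) (joinBlocks 𝒳 a b (x₁, x₂))) :=
        Finset.sum_le_sum fun x₁ _ => Finset.sum_le_sum fun x₂ _ =>
          mul_le_mul_of_nonneg_left (hterm x₁ x₂) (mul_nonneg measureReal_nonneg measureReal_nonneg)
    _ = _ := by
        rw [decoderScore, ← (joinBlocks 𝒳 a b).sum_comp, Fintype.sum_prod_type]
        simp_rw [joinLaw_real_singleton]

/-- The upper bound on the information lost on the second block through the state left by the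
first one, when the decoder ignores the first `N` outputs of the second block. -/
noncomputable def stateLoss (L : ℝ≥0) (N : ℕ) : ℝ :=
  ((∫⁻ w, ‖w‖ₑ ∂(gaussianReal 0 1)) * ((∫⁻ a, ‖a‖ₑ ∂(m 1)) ^ N * (2 * L))).toReal

/-- Superadditivity of the information, up to a constant and an error proportional to the length
of the second block with a small factor. -/
theorem information_add_information_le (hm : m 3 = gaussianReal 0 1)
    (hfin : ∀ j, ∫⁻ a, ‖a‖ₑ ∂(m j) ≠ ∞) (h𝒳 : 𝒳.Nonempty) {L : ℝ≥0}
    (hL : ∀ (n : ℕ) (x : Fin (n + 1) → 𝒳) k,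
      ∫⁻ ζ, ‖chan (extendBlock x) ζ k‖ₑ ∂(noiseLaw m) ≤ L) (N : ℕ) :
    information m a p₁ + information m b p₂ ≤ information m (a + 1 + b) (joinLaw p₁ p₂) +
      (2 * Real.log 2 + (N + 2) * (Real.log 2 + L)) +
      (Real.log 2 + (b + 1) * Real.log 𝒳.card) * stateLoss m L N := by
  obtain ⟨q₁, hq₁, -, h₁⟩ := exists_decoder m hm h𝒳 0 a (hL a) p₁
  obtain ⟨q₂, hq₂, hN, h₂⟩ := exists_decoder m hm h𝒳 N b (hL b) p₂
  have hcard : (0 : ℝ) < 𝒳.card := by exact_mod_cast h𝒳.card_pos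
  have hM : -Real.log (((𝒳.card : ℝ) ^ (b + 1))⁻¹ / 2) =
      Real.log 2 + (b + 1) * Real.log 𝒳.card := by
    rw [Real.log_div (by positivity) (by norm_num), Real.log_inv, Real.log_pow]
    push_cast
    ring
  have hM0 : 0 ≤ Real.log 2 + (b + 1) * Real.log 𝒳.card := by
    have : 0 ≤ Real.log 𝒳.card := Real.log_nonneg (by exact_mod_cast h𝒳.card_pos)
    positivity
  have hgauss : ∫⁻ w, ‖w‖ₑ ∂(gaussianReal 0 1) ≠ ∞ := hm ▸ hfin 3
  have key := decoderScore_joinDecoder_ge m p₁ p₂ hq₁ hq₂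
    (η := (Real.log 2 + (b + 1) * Real.log 𝒳.card) * stateLoss m L N) ?_
  · have h3 := (isDensityChannel_codeLaw m hm (a + 1 + b)).entropy_add_decoderScore_le
      (joinLaw p₁ p₂) (isDecoder_joinDecoder hq₁ hq₂)
    rw [entropy_joinLaw] at h3
    change _ ≤ information m (a + 1 + b) (joinLaw p₁ p₂) at h3
    push_cast at h₁ ⊢
    linarith
  · intro x₁ x₂
    set x := joinBlocks 𝒳 a b (x₁, x₂) with hx
    have hshift : (fun i => extendBlock x (i + (a + 1))) = extendBlock x₂ :=
      funext fun i => extendBlock_joinBlocks_right x₁ x₂ i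
    have hf := enorm_integral_chan_sub_restart_le m hm (x := extendBlock x) (s := a + 1) (L := L)
      (hL _ x) (by rw [hshift]; exact hL _ x₂) (N := N) (h := fun y => Real.log (q₂ x₂ y))
      (hq₂.measurable x₂).log (fun y => (hq₂.abs_log_le x₂ y).trans_eq hM)
      (fun y y' hy => by rw [hN x₂ y y' hy])
    rw [hshift] at hf
    have hne : (∫⁻ w, ‖w‖ₑ ∂(gaussianReal 0 1)) * ((∫⁻ a, ‖a‖ₑ ∂(m 1)) ^ N * (2 * L)) ≠ ∞ :=
      ENNReal.mul_ne_top hgauss (ENNReal.mul_ne_top (ENNReal.pow_ne_top (hfin 1))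
        (ENNReal.mul_ne_top (by norm_num) ENNReal.coe_ne_top))
    rw [mul_assoc, ← ENNReal.ofReal_toReal hne, ← ENNReal.ofReal_mul hM0,
      Real.enorm_eq_ofReal_abs, ENNReal.ofReal_le_ofReal_iff
        (mul_nonneg hM0 ENNReal.toReal_nonneg)] at hf
    have := (abs_le.1 hf).1
    rw [stateLoss]
    linarith

end Concatenation

/-! ### Existence of the limit -/

section Limit

/-- A version of Fekete's lemma: a nonnegative sequence of at most linear growth which is
superadditive up to constants and arbitrarily small linear errors has a mean growth rate. -/
theorem exists_tendsto_div_of_almost_superadditive {u : ℕ → ℝ} {c : ℝ} (h0 : ∀ k, 0 ≤ u k)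
    (hc : ∀ k, u k ≤ c * k)
    (h : ∀ ε > 0, ∃ K, ∀ j k, 1 ≤ j → 1 ≤ k → u j + u k ≤ u (j + k) + K + ε * k) :
    ∃ l, 0 ≤ l ∧ Tendsto (fun k => u k / k) atTop (𝓝 l) := by
  set v : ℕ → ℝ := fun k => u k / k with hv
  have hv0 : ∀ k, 0 ≤ v k := fun k => div_nonneg (h0 k) k.cast_nonneg
  have hc0 : 0 ≤ c := by simpa using (h0 1).trans (hc 1)
  have hvc : ∀ k, v k ≤ c := fun k => div_le_of_le_mul₀ k.cast_nonneg hc0 (hc k)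
  have hbdd : IsBoundedUnder (· ≤ ·) atTop v := isBoundedUnder_of ⟨c, hvc⟩
  have hbdd' : IsBoundedUnder (· ≥ ·) atTop v := isBoundedUnder_of ⟨0, hv0⟩
  set l := limsup v atTop with hl
  have hupper : ∀ ε > 0, ∀ᶠ k in atTop, v k < l + ε := fun ε hε =>
    eventually_lt_of_limsup_lt (by linarith) hbdd
  have hlower : ∀ ε > 0, ∀ᶠ k in atTop, l - ε < v k := by
    intro ε hε
    obtain ⟨K, hK⟩ := h (ε / 4) (by positivity)
    have hfreq : ∃ᶠ n in atTop, l - ε / 4 < v n :=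
      frequently_lt_of_lt_limsup hbdd'.isCoboundedUnder_le (by linarith)
    have hKn : ∀ᶠ n : ℕ in atTop, K / n < ε / 4 :=
      (tendsto_const_div_atTop_nhds_zero_nat K).eventually_lt_const (by positivity)
    obtain ⟨n, hn, hKn, hn1⟩ := (hfreq.and_eventually (hKn.and (eventually_ge_atTop 1))).exists
    have hn0 : (0 : ℝ) < n := by exact_mod_cast hn1
    set b := u n - K - ε / 4 * n with hb
    have hbn : l - 3 * ε / 4 < b / n := by
      have : b / n = v n - K / n - ε / 4 := by simp only [hb, hv]; field_simp
      rw [this]; linarith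
    have hiter : ∀ q j, 1 ≤ j → u j + q * b ≤ u (j + n * q) := by
      intro q
      induction q with
      | zero => intro j _; simp
      | succ q ih =>
        intro j hj
        have h1 := ih j hj
        have h2 := hK (j + n * q) n (by omega) hn1
        have h3 : j + n * (q + 1) = j + n * q + n := by ring
        rw [h3]
        push_cast
        linarith
    -- if `b < 0`, the claim follows from `v ≥ 0`; otherwise `k` is split into steps of length `n`
    -- and a remainder between `1` and `n`
    rcases lt_or_ge b 0 with hb0 | hb0
    · have : b / n < 0 := div_neg_of_neg_of_pos hb0 hn0
      exact Eventually.of_forall fun k => by linarith [hv0 k]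
    have hbk : ∀ᶠ k : ℕ in atTop, b / k < ε / 4 :=
      (tendsto_const_div_atTop_nhds_zero_nat b).eventually_lt_const (by positivity)
    filter_upwards [hbk, eventually_ge_atTop 1] with k hk hk1
    have hk0 : (0 : ℝ) < k := by exact_mod_cast hk1
    have hdiv := Nat.div_add_mod (k - 1) n
    have hmod := Nat.mod_lt (k - 1) hn1
    have h1 := hiter ((k - 1) / n) ((k - 1) % n + 1) (by omega)
    have h2 : (k - 1) % n + 1 + n * ((k - 1) / n) = k := by omega
    rw [h2] at h1
    have h3 : (k : ℝ) ≤ n * (((k - 1) / n : ℕ) : ℝ) + n := by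
      have : k ≤ n * ((k - 1) / n) + n := by omega
      exact_mod_cast this
    have h4 : (k : ℝ) / n - 1 ≤ (((k - 1) / n : ℕ) : ℝ) := by
      rw [sub_le_iff_le_add, div_le_iff₀ hn0]
      linarith
    have h5 : ((k : ℝ) / n - 1) * b ≤ u k := by
      have := mul_le_mul_of_nonneg_right h4 hb0
      linarith [h0 ((k - 1) % n + 1)]
    have h6 : b / n - b / k ≤ v k := by
      have : b / n - b / k = ((k : ℝ) / n - 1) * b / k := by field_simp
      rw [this]
      exact div_le_div_of_nonneg_right h5 hk0.le
    linarith
  refine ⟨l, ge_of_tendsto' (f := fun k => v k) (x := atTop) ?_ hv0, ?_⟩ <;>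
  · refine Metric.tendsto_nhds.2 fun ε hε => ?_
    filter_upwards [hupper ε hε, hlower ε hε] with k h1 h2
    rw [Real.dist_eq, abs_lt]
    constructor <;> linarith

end Limit

section NoiseLaws

theorem lintegral_enorm_gaussianReal_le (v : ℝ≥0) :
    ∫⁻ a, ‖a‖ₑ ∂(gaussianReal 0 v) ≤ ENNReal.ofReal ((v + 1) / 2) := by
  have h2 : MemLp id 2 (gaussianReal 0 v) := memLp_id_gaussianReal 2
  have hsq : Integrable (fun a : ℝ => a ^ 2) (gaussianReal 0 v) := h2.integrable_sq
  have hvar : ∫ a, a ^ 2 ∂(gaussianReal 0 v) = v := by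
    have h := variance_of_integral_eq_zero (X := id) (μ := gaussianReal 0 v) aemeasurable_id (by simp)
    rw [variance_id_gaussianReal] at h
    exact h.symm
  calc ∫⁻ a, ‖a‖ₑ ∂(gaussianReal 0 v)
      ≤ ∫⁻ a, ENNReal.ofReal ((a ^ 2 + 1) / 2) ∂(gaussianReal 0 v) := by
        refine lintegral_mono fun a => ?_
        rw [Real.enorm_eq_ofReal_abs]
        refine ENNReal.ofReal_le_ofReal ?_
        -- `2 * |a| ≤ a ^ 2 + 1`
        nlinarith [sq_abs a, sq_nonneg (|a| - 1)]
    _ = ENNReal.ofReal (∫ a, (a ^ 2 + 1) / 2 ∂(gaussianReal 0 v)) :=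
        (ofReal_integral_eq_lintegral_ofReal ((hsq.add (integrable_const _)).div_const _)
          (ae_of_all _ fun a => div_nonneg (add_nonneg (sq_nonneg a) zero_le_one) zero_le_two)).symm
    _ = ENNReal.ofReal ((v + 1) / 2) := by
        rw [integral_div, integral_add hsq (integrable_const _), hvar]
        simp

theorem lintegral_enorm_cond_Ioo_ne_top {α₁ α₂ : ℝ} :
    ∫⁻ a, ‖a‖ₑ ∂(ProbabilityTheory.cond volume (Set.Ioo α₁ α₂)) ≠ ∞ := by
  refine ne_top_of_le_ne_top (b := ENNReal.ofReal (max |α₁| |α₂|) * 1) (by simp) ?_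
  calc ∫⁻ a, ‖a‖ₑ ∂(ProbabilityTheory.cond volume (Set.Ioo α₁ α₂))
      ≤ ∫⁻ _, ENNReal.ofReal (max |α₁| |α₂|)
          ∂(ProbabilityTheory.cond volume (Set.Ioo α₁ α₂)) := by
        refine lintegral_mono_ae ?_
        filter_upwards [ProbabilityTheory.ae_cond_mem measurableSet_Ioo] with a ha
        rw [Real.enorm_eq_ofReal_abs]
        exact ENNReal.ofReal_le_ofReal (abs_le_max_abs_abs ha.1.le ha.2.le)
    _ ≤ _ := by
        rw [lintegral_const]
        exact mul_le_mul_right prob_le_one _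

/-- The laws of the five noise processes `A, B, E, W, U`. -/
noncomputable def noiseMarginals (σA σB σE : ℝ≥0) (α₁ α₂ : ℝ) : Fin 5 → Measure ℝ :=
  ![gaussianReal 0 (σA ^ 2), gaussianReal 0 (σB ^ 2), gaussianReal 0 (σE ^ 2), gaussianReal 0 1,
    ProbabilityTheory.cond volume (Set.Ioo α₁ α₂)]

theorem isProbabilityMeasure_noiseMarginals (σA σB σE : ℝ≥0) {α₁ α₂ : ℝ} (h : α₁ < α₂) (j : Fin 5) :
    IsProbabilityMeasure (noiseMarginals σA σB σE α₁ α₂ j) := by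
  have hU : IsProbabilityMeasure (ProbabilityTheory.cond (volume : Measure ℝ) (Set.Ioo α₁ α₂)) :=
    ProbabilityTheory.cond_isProbabilityMeasure_of_finite (by simp [h]) (by simp)
  fin_cases j
  exacts [instIsProbabilityMeasureGaussianReal _ _, instIsProbabilityMeasureGaussianReal _ _,
    instIsProbabilityMeasureGaussianReal _ _, instIsProbabilityMeasureGaussianReal _ _, hU]

theorem lintegral_enorm_noiseMarginals_ne_top (σA σB σE : ℝ≥0) (α₁ α₂ : ℝ) (j : Fin 5) :
    ∫⁻ a, ‖a‖ₑ ∂(noiseMarginals σA σB σE α₁ α₂ j) ≠ ∞ := by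
  have hG : ∀ v, ∫⁻ a, ‖a‖ₑ ∂(gaussianReal 0 v) ≠ ∞ := fun v =>
    ne_top_of_le_ne_top ENNReal.ofReal_ne_top (lintegral_enorm_gaussianReal_le v)
  fin_cases j
  exacts [hG _, hG _, hG _, hG _, lintegral_enorm_cond_Ioo_ne_top]

theorem IsNoise.map_eq {Ω : Type*} [MeasurableSpace Ω] {P : Measure Ω} [IsProbabilityMeasure P]
    {σA σB σE : ℝ≥0} {α₁ α₂ : ℝ} {A B E W U : ℕ → Ω → ℝ}
    (h : IsNoise P σA σB σE α₁ α₂ A B E W U)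
    [∀ j, IsProbabilityMeasure (noiseMarginals σA σB σE α₁ α₂ j)] :
    Measurable (fun ω (q : Fin 5 × ℕ) => (![A, B, E, W, U] : Fin 5 → ℕ → Ω → ℝ) q.1 q.2 ω) ∧
    P.map (fun ω q => (![A, B, E, W, U] : Fin 5 → ℕ → Ω → ℝ) q.1 q.2 ω) =
      noiseLaw (noiseMarginals σA σB σE α₁ α₂) := by
  have hmeas : ∀ q : Fin 5 × ℕ, Measurable ((![A, B, E, W, U] : Fin 5 → ℕ → Ω → ℝ) q.1 q.2) := by
    rintro ⟨j, i⟩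
    fin_cases j
    exacts [h.measurable_A i, h.measurable_B i, h.measurable_E i, h.measurable_W i,
      h.measurable_U i]
  have hlaw : ∀ q : Fin 5 × ℕ, P.map ((![A, B, E, W, U] : Fin 5 → ℕ → Ω → ℝ) q.1 q.2) =
      noiseMarginals σA σB σE α₁ α₂ q.1 := by
    rintro ⟨j, i⟩
    fin_cases j
    exacts [h.law_A i, h.law_B i, h.law_E i, h.law_W i, h.law_U i]
  refine ⟨measurable_pi_lambda _ hmeas, ?_⟩
  rw [h.indep.map_fun_eq_infinitePi_map hmeas, noiseLaw]
  congr 1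
  funext q
  exact hlaw q

end NoiseLaws

section Capacity

theorem exists_forall_enorm_extendBlock_le (𝒳 : Finset ℝ) :
    ∃ X : ℝ≥0, ∀ (n : ℕ) (x : Fin (n + 1) → 𝒳) i, ‖extendBlock x i‖ₑ ≤ X := by
  refine ⟨∑ a ∈ 𝒳, ‖a‖₊, fun n x i => ?_⟩
  rw [extendBlock]
  split_ifs with hi
  · rw [enorm_eq_nnnorm]
    exact_mod_cast Finset.single_le_sum (f := fun a : ℝ => ‖a‖₊) (fun _ _ => zero_le)
      (x ⟨i, hi⟩).2
  · simp

theorem blockInfo_eq_ofReal {Ω : Type*} [MeasurableSpace Ω] {P : Measure Ω}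
    [IsProbabilityMeasure P] {m : Fin 5 → Measure ℝ} [∀ j, IsProbabilityMeasure (m j)]
    (hm : m 3 = gaussianReal 0 1) {A B E W U : ℕ → Ω → ℝ}
    (hmeas : Measurable
      (fun ω (q : Fin 5 × ℕ) => (![A, B, E, W, U] : Fin 5 → ℕ → Ω → ℝ) q.1 q.2 ω))
    (hlaw : P.map (fun ω q => (![A, B, E, W, U] : Fin 5 → ℕ → Ω → ℝ) q.1 q.2 ω) = noiseLaw m)
    {𝒳 : Finset ℝ} {n : ℕ} (p : ProbabilityMeasure (Fin (n + 1) → 𝒳)) :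
    blockInfo P A B E W U p = ENNReal.ofReal (information m n (p : Measure (Fin (n + 1) → 𝒳))) := by
  have heq : ∀ x : Fin (n + 1) → 𝒳, outputBlock A B E W U x =
      (fun ζ (i : Fin (n + 1)) => chan (extendBlock x) ζ i) ∘
        fun ω q => (![A, B, E, W, U] : Fin 5 → ℕ → Ω → ℝ) q.1 q.2 ω := by
    intro x
    funext ω i
    exact output_eq_chan A B E W U (extendBlock x) ω i
  rw [blockInfo]
  refine (isDensityChannel_codeLaw m hm n).mutualInfo_eq _ P (fun x => ?_) fun x => ?_
  · rw [heq]
    exact (measurable_chan_block _ n).comp hmeas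
  · rw [heq, ← Measure.map_map (measurable_chan_block _ n) hmeas, hlaw]
    rfl

/-- The information capacity exists for any noise with finite first absolute moments such that
`W` is standard Gaussian and `E|B| < 1`. -/
theorem exists_tendsto_blockCapacity {Ω : Type*} [MeasurableSpace Ω] {P : Measure Ω}
    [IsProbabilityMeasure P] {m : Fin 5 → Measure ℝ} [∀ j, IsProbabilityMeasure (m j)]
    (hm : m 3 = gaussianReal 0 1) (hfin : ∀ j, ∫⁻ a, ‖a‖ₑ ∂(m j) ≠ ∞)
    (hB : ∫⁻ a, ‖a‖ₑ ∂(m 1) < 1) {A B E W U : ℕ → Ω → ℝ}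
    (hmeas : Measurable
      (fun ω (q : Fin 5 × ℕ) => (![A, B, E, W, U] : Fin 5 → ℕ → Ω → ℝ) q.1 q.2 ω))
    (hlaw : P.map (fun ω q => (![A, B, E, W, U] : Fin 5 → ℕ → Ω → ℝ) q.1 q.2 ω) = noiseLaw m)
    {𝒳 : Finset ℝ} (h𝒳 : 𝒳.Nonempty) :
    (∀ n : ℕ, blockCapacity P A B E W U 𝒳 n ≠ ∞) ∧
    ∃ C : ℝ≥0, Tendsto (fun n : ℕ => blockCapacity P A B E W U 𝒳 n) atTop (𝓝 (C : ℝ≥0∞)) := by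
  obtain ⟨X, hX⟩ := exists_forall_enorm_extendBlock_le 𝒳
  obtain ⟨L, hL'⟩ := exists_forall_lintegral_enorm_chan_le m hfin hB X
  have hL : ∀ (n : ℕ) (x : Fin (n + 1) → 𝒳) k,
      ∫⁻ ζ, ‖chan (extendBlock x) ζ k‖ₑ ∂(noiseLaw m) ≤ L := fun n x => hL' _ (hX n x)
  have : Nonempty 𝒳 := h𝒳.to_subtype
  have hlog : 0 ≤ Real.log 𝒳.card := Real.log_nonneg (by exact_mod_cast h𝒳.card_pos)
  have hinfo : ∀ n (p : ProbabilityMeasure (Fin (n + 1) → 𝒳)),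
      blockInfo P A B E W U p = ENNReal.ofReal (information m n (p : Measure (Fin (n + 1) → 𝒳))) := fun n p =>
    blockInfo_eq_ofReal hm hmeas hlaw p
  have hcard : ∀ n (p : ProbabilityMeasure (Fin (n + 1) → 𝒳)),
      information m n (p : Measure (Fin (n + 1) → 𝒳)) ≤ Real.log 𝒳.card * (n + 1 : ℕ) := fun n p => by
    refine ((isDensityChannel_codeLaw m (𝒳 := 𝒳) hm n).information_le_log_card p).trans_eq ?_
    simp [Real.log_pow, mul_comm]
  have hpos : ∀ n (p : ProbabilityMeasure (Fin (n + 1) → 𝒳)), 0 ≤ information m n (p : Measure (Fin (n + 1) → 𝒳)) := fun n p =>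
    (isDensityChannel_codeLaw m (𝒳 := 𝒳) hm n).information_nonneg p
  set S : ℕ → ℝ≥0∞ := fun n => ⨆ p : ProbabilityMeasure (Fin (n + 1) → 𝒳), blockInfo P A B E W U p
    with hS
  have hSle : ∀ n, S n ≤ ENNReal.ofReal (Real.log 𝒳.card * (n + 1 : ℕ)) := fun n =>
    iSup_le fun p => by rw [hinfo]; exact ENNReal.ofReal_le_ofReal (hcard n p)
  have hStop : ∀ n, S n ≠ ∞ := fun n => ne_top_of_le_ne_top ENNReal.ofReal_ne_top (hSle n)
  have hleS : ∀ n (p : ProbabilityMeasure (Fin (n + 1) → 𝒳)),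
      information m n (p : Measure (Fin (n + 1) → 𝒳)) ≤ (S n).toReal := fun n p => by
    rw [← ENNReal.toReal_ofReal (hpos n p), ← hinfo]
    exact ENNReal.toReal_mono (hStop n) (le_iSup (fun p => blockInfo P A B E W U p) p)
  have hSsup : ∀ n (T : ℝ), (∀ p : ProbabilityMeasure (Fin (n + 1) → 𝒳), information m n (p : Measure (Fin (n + 1) → 𝒳)) ≤ T) →
      (S n).toReal ≤ T := fun n T hT => by
    have p₀ : ProbabilityMeasure (Fin (n + 1) → 𝒳) := ⟨Measure.dirac (Classical.arbitrary _),
      inferInstance⟩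
    refine ENNReal.toReal_le_of_le_ofReal ((hpos n p₀).trans (hT p₀)) (iSup_le fun p => ?_)
    rw [hinfo]
    exact ENNReal.ofReal_le_ofReal (hT p)
  have hsuper : ∀ N a b, (S a).toReal + (S b).toReal ≤ (S (a + 1 + b)).toReal +
      (2 * Real.log 2 + (N + 2) * (Real.log 2 + L)) +
      (Real.log 2 + (b + 1) * Real.log 𝒳.card) * stateLoss m L N := by
    intro N a b
    rw [← le_sub_iff_add_le]
    refine hSsup a _ fun p₁ => ?_
    rw [le_sub_iff_add_le, ← le_sub_iff_add_le']
    refine hSsup b _ fun p₂ => ?_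
    have h1 := information_add_information_le m (p₁ : Measure (Fin (a + 1) → 𝒳))
      (p₂ : Measure (Fin (b + 1) → 𝒳)) hm hfin h𝒳 hL N
    have h2 := hleS (a + 1 + b) ⟨joinLaw (p₁ : Measure (Fin (a + 1) → 𝒳))
      (p₂ : Measure (Fin (b + 1) → 𝒳)), inferInstance⟩
    rw [ProbabilityMeasure.coe_mk] at h2
    linarith
  -- the state loss is a constant multiple of `E|B| ^ N`
  have hloss : Tendsto (stateLoss m L) atTop (𝓝 0) := by
    have h1 : Tendsto (fun N => (∫⁻ a, ‖a‖ₑ ∂(m 1)).toReal ^ N) atTop (𝓝 0) :=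
      tendsto_pow_atTop_nhds_zero_of_lt_one ENNReal.toReal_nonneg
        (by rw [← ENNReal.toReal_one]; exact (ENNReal.toReal_lt_toReal (hfin 1) (by simp)).2 hB)
    have h2 := h1.const_mul ((∫⁻ w, ‖w‖ₑ ∂(gaussianReal 0 1)).toReal * (2 * L))
    rw [mul_zero] at h2
    refine h2.congr fun N => ?_
    rw [stateLoss, ENNReal.toReal_mul, ENNReal.toReal_mul, ENNReal.toReal_mul, ENNReal.toReal_pow]
    simp
    ring
  -- `u k` is the supremum for blocks of length `k`, that is, with last index `k - 1`
  obtain ⟨l, hl0, hl⟩ := exists_tendsto_div_of_almost_superadditive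
    (u := fun k => if k = 0 then 0 else (S (k - 1)).toReal) (c := Real.log 𝒳.card)
    (fun k => by split_ifs <;> simp) (fun k => by
      split_ifs with hk
      · simp [hk]
      · refine hSsup _ _ fun p => (hcard _ p).trans_eq ?_
        rw [Nat.sub_add_cancel (Nat.one_le_iff_ne_zero.2 hk)]) (fun ε hε => by
      set c := Real.log 2 + Real.log 𝒳.card with hc
      have hc0 : 0 < c := by have := Real.log_pos one_lt_two; linarith
      obtain ⟨N, hN⟩ := (hloss.eventually_lt_const (div_pos hε hc0)).exists
      refine ⟨2 * Real.log 2 + (N + 2) * (Real.log 2 + L), fun j k hj hk => ?_⟩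
      obtain ⟨a, rfl⟩ := Nat.exists_eq_add_of_le' hj
      obtain ⟨b, rfl⟩ := Nat.exists_eq_add_of_le' hk
      rw [if_neg (by omega), if_neg (by omega), if_neg (by omega), Nat.add_sub_cancel,
        Nat.add_sub_cancel, show a + 1 + (b + 1) - 1 = a + 1 + b by omega]
      refine (hsuper N a b).trans (add_le_add_right ?_ _)
      have h1 : stateLoss m L N * c ≤ ε := by
        rw [lt_div_iff₀ hc0] at hN
        exact hN.le
      have h2 : Real.log 2 + (b + 1) * Real.log 𝒳.card ≤ c * (b + 1 : ℕ) := by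
        have h3 : 0 ≤ Real.log 2 * b := by positivity
        push_cast
        rw [hc]
        linarith
      calc _ ≤ c * (b + 1 : ℕ) * stateLoss m L N :=
            mul_le_mul_of_nonneg_right h2 ENNReal.toReal_nonneg
        _ = stateLoss m L N * c * (b + 1 : ℕ) := by ring
        _ ≤ ε * (b + 1 : ℕ) := mul_le_mul_of_nonneg_right h1 (Nat.cast_nonneg _))
  have hcap : ∀ n, blockCapacity P A B E W U 𝒳 n =
      ENNReal.ofReal ((S n).toReal / (n + 1 : ℕ)) := fun n => by
    rw [ENNReal.ofReal_div_of_pos (by positivity), ENNReal.ofReal_toReal (hStop n),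
      ENNReal.ofReal_natCast, blockCapacity]
    simp [hS]
  refine ⟨fun n => by rw [hcap]; exact ENNReal.ofReal_ne_top, ⟨l, hl0⟩, ?_⟩
  simp_rw [hcap]
  have h1 := (hl.comp (tendsto_add_atTop_nat 1))
  have h2 := ENNReal.tendsto_ofReal h1
  rw [ENNReal.ofReal_eq_coe_nnreal hl0] at h2
  exact h2

end Capacity
end FlashChannel

theorem mainTheorem4 {Ω : Type*} [MeasurableSpace Ω] (P : Measure Ω) [IsProbabilityMeasure P]
    (𝒳 : Finset ℝ) (h𝒳 : 𝒳.Nonempty)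
    (σA σB σE : ℝ≥0) (hσB_pos : 0 < σB ^ 2) (hσB_lt : σB ^ 2 < 1)
    (α₁ α₂ : ℝ) (hα₁ : 0 < α₁) (hα₁₂ : α₁ < α₂)
    (A B E W U : ℕ → Ω → ℝ)
    (hnoise : FlashChannel.IsNoise P σA σB σE α₁ α₂ A B E W U) :
    (∀ n : ℕ, FlashChannel.blockCapacity P A B E W U 𝒳 n ≠ ∞) ∧
    ∃ C : ℝ≥0, Tendsto (fun n : ℕ => FlashChannel.blockCapacity P A B E W U 𝒳 n) atTop
      (𝓝 (C : ℝ≥0∞)) := by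
  have := FlashChannel.isProbabilityMeasure_noiseMarginals σA σB σE hα₁₂
  obtain ⟨hmeas, hlaw⟩ := hnoise.map_eq
  refine FlashChannel.exists_tendsto_blockCapacity
    (m := FlashChannel.noiseMarginals σA σB σE α₁ α₂) rfl
    (FlashChannel.lintegral_enorm_noiseMarginals_ne_top σA σB σE α₁ α₂) ?_ hmeas hlaw h𝒳
  -- `E|B| ≤ (σB ^ 2 + 1) / 2 < 1`
  refine (FlashChannel.lintegral_enorm_gaussianReal_le (σB ^ 2)).trans_lt ?_
  rw [ENNReal.ofReal_lt_one]
  have : ((σB ^ 2 : ℝ≥0) : ℝ) < 1 := by exact_mod_cast hσB_lt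
  linarith
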